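/- Let $(M,g)$ be a closed (compact, without boundary) connected smooth Riemannian manifold of dimension $4$, with volume measure $dV$. Let $a,c\in C^\infty(M)$ with $a>0$ on $M$, and consider the operator $$Lu=-\operatorname{div}(a\nabla u)+c\,u .$$ Assume that its first eigenvalue is non-negative: $$\lambda_1:=\inf_{u\in H^1(M),\,u\not\equiv0}\frac{\int_M\left(a|\nabla u|^2+c\,u^2\right)dV}{\int_M u^2\,dV}\;\ge\;0 .$$ For positive functions $u$ on $M$ put $$\mathfrak D(u)=\left(\int_M u^{-4}\,dV\right)^{\frac12}\int_M\left(a|\nabla u|^2+c\,u^2\right)dV,\qquad \hat{\mathcal D}=\inf_{0<u\in C^\infty(M)}\mathfrak D(u).$$ Solutions are understood in the classical sense, i.e. they are functions in $C^2(M)$ that satisfy the equation at every point of $M$. (i) If $u_1>0$ and $u_2>0$ are two solutions of $$Lu=\mathfrak D(u)\left(\int_M u^{-4}\,dV\right)^{-\frac32}u^{-5}\quad\text{in }M,$$ then there is a constant $\beta>0$ such that $u_1=\beta u_2$ in $M$. (ii) If $u_1>0$ and $u_2>0$ are two solutions of $$Lu=\hat{\mathcal D}\left(\int_M u^{-4}\,dV\right)^{-\frac32}u^{-5}\quad\text{in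 }M,$$ then there is a constant $\beta>0$ such that $u_1=\beta u_2$ in $M$. -/

import Mathlib

open Bundle MeasureTheory Filter
open scoped Manifold ContDiff Topology ENNReal

noncomputable section

/-! Riemannian calculus on an `n`-dimensional smooth manifold without boundary (charts in
`EuclideanSpace ℝ (Fin n)`), the metric being given by an inner product on each tangent space. -/

namespace ConformalPDE

section Calculus

variable {n : ℕ} {M : Type*} [TopologicalSpace M] [ChartedSpace (EuclideanSpace ℝ (Fin n)) M]

/-- The coordinate vector field `∂ⱼ` of the chart centred at `p`, at the point with coordinates
`y`: the image of the `j`-th basis vector under the differential of the inverse chart. -/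
def coordVec (p : M) (y : EuclideanSpace ℝ (Fin n)) (j : Fin n) :
    TangentSpace (𝓡 n) ((chartAt (EuclideanSpace ℝ (Fin n)) p).symm y) :=
  mfderiv (𝓡 n) (𝓡 n) (chartAt (EuclideanSpace ℝ (Fin n)) p).symm y
    (EuclideanSpace.single j (1 : ℝ) : EuclideanSpace ℝ (Fin n))

/-- The `j`-th component, in the chart centred at `p`, of the vector field `X`, as a function of
the coordinates `y`. -/
def vecComponent (X : ∀ x : M, TangentSpace (𝓡 n) x) (p : M) (j : Fin n)
    (y : EuclideanSpace ℝ (Fin n)) : ℝ :=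
  let v : EuclideanSpace ℝ (Fin n) :=
    mfderiv (𝓡 n) (𝓡 n) (chartAt (EuclideanSpace ℝ (Fin n)) p)
      ((chartAt (EuclideanSpace ℝ (Fin n)) p).symm y)
      (X ((chartAt (EuclideanSpace ℝ (Fin n)) p).symm y))
  v j

variable [RiemannianBundle (fun x : M ↦ TangentSpace (𝓡 n) x)]

/-- The matrix `gⱼₖ` of the metric in the chart centred at `p`. -/
def gramMatrix (p : M) (y : EuclideanSpace ℝ (Fin n)) : Matrix (Fin n) (Fin n) ℝ :=
  Matrix.of fun j k ↦ inner ℝ (coordVec p y j) (coordVec p y k)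

/-- The density `√det(gⱼₖ)` of the Riemannian volume in the chart centred at `p`. -/
def volDensity (p : M) (y : EuclideanSpace ℝ (Fin n)) : ℝ :=
  √ (gramMatrix p y).det

/-- The gradient of `u`, characterized by `⟨∇u(x), v⟩ = du(x) v` for all tangent vectors `v`. -/
def grad (u : M → ℝ) (x : M) : TangentSpace (𝓡 n) x :=
  haveI : FiniteDimensional ℝ (TangentSpace (𝓡 n) x) :=
    inferInstanceAs (FiniteDimensional ℝ (EuclideanSpace ℝ (Fin n)))
  haveI : CompleteSpace (TangentSpace (𝓡 n) x) := FiniteDimensional.complete ℝ _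
  (InnerProductSpace.toDual ℝ (TangentSpace (𝓡 n) x)).symm (mfderiv (𝓡 n) 𝓘(ℝ, ℝ) u x)

/-- The Riemannian divergence, `div X = (1 / √det g) ∑ⱼ ∂ⱼ (√det g Xʲ)`, computed at `x` in the
chart centred at `x`. -/
def divergence (X : ∀ x : M, TangentSpace (𝓡 n) x) (x : M) : ℝ :=
  (volDensity x (chartAt (EuclideanSpace ℝ (Fin n)) x x))⁻¹ *
    ∑ j : Fin n, fderiv ℝ (fun y ↦ volDensity x y * vecComponent X x j y)
      (chartAt (EuclideanSpace ℝ (Fin n)) x x) (EuclideanSpace.single j (1 : ℝ))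

variable (n) in
/-- The operator `L u = -div(a ∇u) + c u`. -/
def opL (a c u : M → ℝ) (x : M) : ℝ :=
  -divergence (n := n) (fun z ↦ a z • grad u z) x + c x * u x

end Calculus

section Volume

variable {n : ℕ} {M : Type*} [TopologicalSpace M] [ChartedSpace (EuclideanSpace ℝ (Fin n)) M]
  [RiemannianBundle (fun x : M ↦ TangentSpace (𝓡 n) x)] [MeasurableSpace M]

/-- The Riemannian volume of the domain of the chart centred at `p`: the image under the inverse
chart of the measure `√det(gⱼₖ) dy`. -/
def chartVolume (p : M) : Measure M :=
  Measure.map (chartAt (EuclideanSpace ℝ (Fin n)) p).symm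
    ((volume.restrict (chartAt (EuclideanSpace ℝ (Fin n)) p).target).withDensity
      fun y ↦ ENNReal.ofReal (volDensity p y))

variable (n M) in
/-- The Riemannian volume measure `dV` of a closed manifold, glued from the chart volumes by a
smooth partition of unity subordinate to the chart domains. (The result does not depend on the
partition of unity.) -/
def riemannianVolume [T2Space M] [CompactSpace M] [IsManifold (𝓡 n) ∞ M] : Measure M :=
  Measure.sum fun p : M ↦ (chartVolume (n := n) p).withDensity fun x ↦
    ENNReal.ofReal
      ((SmoothPartitionOfUnity.exists_isSubordinate_chartAt_source (𝓡 n) M).choose p x)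

end Volume

section Functionals

variable {n : ℕ} {M : Type*} [TopologicalSpace M] [T2Space M] [CompactSpace M]
  [ChartedSpace (EuclideanSpace ℝ (Fin n)) M] [IsManifold (𝓡 n) ∞ M]
  [RiemannianBundle (fun x : M ↦ TangentSpace (𝓡 n) x)] [MeasurableSpace M]

/-- `u` belongs to the Sobolev space `H¹(M)` and has weak gradient `X`. Here `H¹(M)` is the
completion of `C¹(M)` in the norm `(∫ u² + |∇u|²)^{1/2}`, realized as a space of functions in
`L²(M)`, with gradients in `L²`. A vector field is measurable if its inner products with smooth
vector fields are. -/
structure HasSobolevGradient (u : M → ℝ) (X : ∀ x : M, TangentSpace (𝓡 n) x) : Prop where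
  memLp : MemLp u 2 (riemannianVolume n M)
  aestronglyMeasurable_inner : ∀ Y : ∀ x : M, TangentSpace (𝓡 n) x,
    ContMDiff (𝓡 n) (𝓡 n).tangent ∞ (fun x ↦ (⟨x, Y x⟩ : TangentBundle (𝓡 n) M)) →
      AEStronglyMeasurable (fun x ↦ (inner ℝ (X x) (Y x) : ℝ)) (riemannianVolume n M)
  integrable_norm_sq : Integrable (fun x ↦ ‖X x‖ ^ 2) (riemannianVolume n M)
  approx : ∃ φ : ℕ → M → ℝ, (∀ k, ContMDiff (𝓡 n) 𝓘(ℝ, ℝ) 1 (φ k)) ∧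
    Tendsto (fun k ↦ ∫⁻ x, ‖φ k x - u x‖ₑ ^ 2 ∂(riemannianVolume n M)) atTop (𝓝 0) ∧
    Tendsto (fun k ↦ ∫⁻ x, ‖grad (φ k) x - X x‖ₑ ^ 2 ∂(riemannianVolume n M)) atTop (𝓝 0)

variable (n) in
/-- The first eigenvalue of `L`: the infimum over all `u ∈ H¹(M)`, `u ≢ 0`, of the Rayleigh
quotient `∫ (a |∇u|² + c u²) / ∫ u²`. (For bounded `c` and `a ≥ 0` the set of quotients is bounded
below, and it is non-empty.) -/
def firstEigenvalue (a c : M → ℝ) : ℝ :=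
  sInf {r : ℝ | ∃ (u : M → ℝ) (X : ∀ x : M, TangentSpace (𝓡 n) x),
    HasSobolevGradient u X ∧ ¬ (u =ᵐ[riemannianVolume n M] 0) ∧
    r = (∫ x, (a x * ‖X x‖ ^ 2 + c x * u x ^ 2) ∂(riemannianVolume n M)) /
      ∫ x, u x ^ 2 ∂(riemannianVolume n M)}

variable (n) in
/-- `∫ u⁻⁴ dV`. -/
def intInvFour (u : M → ℝ) : ℝ :=
  ∫ x, (u x ^ 4)⁻¹ ∂(riemannianVolume n M)

variable (n) in
/-- The functional `𝔇(u) = (∫ u⁻⁴ dV)^{1/2} ∫ (a |∇u|² + c u²) dV`. -/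
def functionalD (a c u : M → ℝ) : ℝ :=
  intInvFour n u ^ (1 / 2 : ℝ) *
    ∫ x, (a x * ‖(grad u x : TangentSpace (𝓡 n) x)‖ ^ 2 + c x * u x ^ 2) ∂(riemannianVolume n M)

variable (n) in
/-- The infimum of `𝔇` over the positive smooth functions on `M`. -/
def infD (a c : M → ℝ) : ℝ :=
  sInf {r : ℝ | ∃ u : M → ℝ, ContMDiff (𝓡 n) 𝓘(ℝ, ℝ) ∞ u ∧ (∀ x, 0 < u x) ∧
    r = functionalD n a c u}

variable (n) in
/-- `u` is a positive classical solution on `M` of `L u = d (∫ u⁻⁴ dV)^{-3/2} u⁻⁵`. -/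
structure IsPositiveSolution (a c : M → ℝ) (d : ℝ) (u : M → ℝ) : Prop where
  contMDiff : ContMDiff (𝓡 n) 𝓘(ℝ, ℝ) 2 u
  pos : ∀ x, 0 < u x
  eqn : ∀ x, opL n a c u x = d * intInvFour n u ^ (-(3 / 2) : ℝ) * (u x ^ 5)⁻¹

end Functionals

end ConformalPDE

end

/-!
For `L u = -div(a ∇u) + c u` the Lagrange identity `v L u - u L v = -div(a v² ∇(u / v))` holds.
On a closed manifold it integrates, against a non-decreasing function of `u / v`, to a non-negative
number.  If `L u = K₁ u⁻ᵏ` and `L v = K₂ v⁻ᵏ` with `K₁ ≥ 0`, then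
`v L u - u L v = -u v⁻ᵏ g(u / v)` with `g(t) = K₂ - K₁ t⁻⁽ᵏ⁺¹⁾` non-decreasing, so testing with `g`
gives the opposite sign and forces `v L u = u L v`.  Testing with `u / v` itself then yields
`∇(u / v) = 0`.  Here `K₁ ≥ 0` because `λ₁ ≥ 0` makes `𝔇` non-negative.

The divergence theorem follows from integration by parts in charts and a partition of unity.  The
coordinate expression of the divergence does not depend on the chart, since in any two charts it is
continuous and represents the weak divergence.
-/

noncomputable section

namespace ConformalPDE

variable {n : ℕ} {M : Type*} [TopologicalSpace M] [ChartedSpace (EuclideanSpace ℝ (Fin n)) M]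

local notation "ℝⁿ" => EuclideanSpace ℝ (Fin n)
local notation "chart" => chartAt (EuclideanSpace ℝ (Fin n))

section Frames

/-- The differential of the inverse chart centred at `p`, as an endomorphism of the model space. -/
def frame (p : M) (y : ℝⁿ) : ℝⁿ →L[ℝ] ℝⁿ :=
  mfderiv (𝓡 n) (𝓡 n) (chart p).symm y

/-- The differential of the chart centred at `p`, as an endomorphism of the model space. -/
def coframe (p x : M) : ℝⁿ →L[ℝ] ℝⁿ :=
  mfderiv (𝓡 n) (𝓡 n) (chart p) x

/-- The transition map from the chart centred at `p` to the chart centred at `q`. -/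
def transition (p q : M) : OpenPartialHomeomorph ℝⁿ ℝⁿ :=
  (chart p).symm ≫ₕ chart q

/-- The function `φ` in the chart centred at `p`. -/
def inChart (p : M) (φ : M → ℝ) (y : ℝⁿ) : ℝ :=
  φ ((chart p).symm y)

/-- The derivative of `φ` along the vector field `X`. -/
def dirDeriv (φ : M → ℝ) (X : ∀ x : M, TangentSpace (𝓡 n) x) (x : M) : ℝ :=
  mfderiv (𝓡 n) 𝓘(ℝ, ℝ) φ x (X x)

theorem mem_transition_source {p q : M} {y : ℝⁿ} :
    y ∈ (transition p q).source ↔ y ∈ (chart p).target ∧ (chart p).symm y ∈ (chart q).source := by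
  simp [transition]

theorem vecComponent_apply (X : ∀ x : M, TangentSpace (𝓡 n) x) (p : M) (j : Fin n) (y : ℝⁿ) :
    vecComponent X p j y = coframe p ((chart p).symm y) (X ((chart p).symm y)) j :=
  rfl

theorem vecComponent_smul (a : M → ℝ) (X : ∀ x : M, TangentSpace (𝓡 n) x) (p : M) (j : Fin n)
    (y : ℝⁿ) : vecComponent (fun x ↦ a x • X x) p j y = inChart p a y * vecComponent X p j y :=
  congrArg (fun v : ℝⁿ ↦ v j) ((coframe p ((chart p).symm y)).map_smul (inChart p a y)
    (X ((chart p).symm y)))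

variable [IsManifold (𝓡 n) ∞ M]

theorem contDiffOn_transition (p q : M) :
    ContDiffOn ℝ ∞ (transition (n := n) p q) (transition (n := n) p q).source := by
  rw [← contMDiffOn_iff_contDiffOn]
  exact (contMDiffOn_chart (x := q)).comp
    ((contMDiffOn_chart_symm (x := p)).mono fun y hy ↦ (mem_transition_source.1 hy).1)
    fun y hy ↦ (mem_transition_source.1 hy).2

theorem hasFDerivAt_transition {p q : M} {y : ℝⁿ} (hy : y ∈ (transition p q).source) :
    HasFDerivAt (transition p q) (fderiv ℝ (transition p q) y) y :=
  (((contDiffOn_transition p q).contDiffAt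
    ((transition p q).open_source.mem_nhds hy)).differentiableAt (by simp)).hasFDerivAt

theorem mdifferentiable_chart_infty (p : M) :
    (chart p).MDifferentiable (𝓡 n) (𝓡 n) :=
  have : IsManifold (𝓡 n) 1 M := .of_le (n := ∞) (by simp)
  mdifferentiable_chart p

theorem mdifferentiableAt_chart_symm {p : M} {y : ℝⁿ} (hy : y ∈ (chart p).target) :
    MDifferentiableAt (𝓡 n) (𝓡 n) (chart p).symm y :=
  (mdifferentiable_chart_infty p).mdifferentiableAt_symm hy

theorem frame_coframe {p x : M} (hx : x ∈ (chart p).source) (v : ℝⁿ) :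
    frame p (chart p x) (coframe p x v) = v :=
  DFunLike.congr_fun ((mdifferentiable_chart_infty p).symm_comp_deriv hx) v

theorem coframe_frame {p : M} {y : ℝⁿ} (hy : y ∈ (chart p).target) (v : ℝⁿ) :
    coframe p ((chart p).symm y) (frame p y v) = v :=
  DFunLike.congr_fun ((mdifferentiable_chart_infty p).comp_symm_deriv hy) v

theorem frame_coframe_symm {p : M} {y : ℝⁿ} (hy : y ∈ (chart p).target) (v : ℝⁿ) :
    frame p y (coframe p ((chart p).symm y) v) = v := by
  simpa only [(chart p).right_inv hy] using frame_coframe ((chart p).map_target hy) v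

theorem frame_eq_comp_fderiv_transition {p q : M} {y : ℝⁿ} (hy : y ∈ (transition p q).source) :
    frame p y = (frame q (transition p q y)).comp (fderiv ℝ (transition p q) y) := by
  obtain ⟨-, hyq⟩ := mem_transition_source.1 hy
  have hcomp : (chart q).symm ∘ transition p q =ᶠ[𝓝 y] (chart p).symm := by
    filter_upwards [(transition p q).open_source.mem_nhds hy] with z hz
    exact (chart q).left_inv (mem_transition_source.1 hz).2
  have hchain := mfderiv_comp y (mdifferentiableAt_chart_symm ((chart q).map_source hyq))
    (hasFDerivAt_transition hy).differentiableAt.mdifferentiableAt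
  rw [mfderiv_eq_fderiv] at hchain
  exact (hcomp.mfderiv_eq (I := 𝓡 n) (I' := 𝓡 n)).symm.trans hchain

theorem contDiffOn_inChart {m : WithTop ℕ∞} (hm : m ≤ (∞ : WithTop ℕ∞)) (p : M) {φ : M → ℝ}
    (hφ : ContMDiff (𝓡 n) 𝓘(ℝ, ℝ) m φ) : ContDiffOn ℝ m (inChart p φ) (chart p).target := by
  have : IsManifold (𝓡 n) m M := .of_le hm
  rw [← contMDiffOn_iff_contDiffOn]
  exact hφ.comp_contMDiffOn (contMDiffOn_chart_symm (x := p))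

theorem fderiv_inChart {p : M} {y : ℝⁿ} (hy : y ∈ (chart p).target) {φ : M → ℝ}
    (hφ : MDifferentiable (𝓡 n) 𝓘(ℝ, ℝ) φ) (v : ℝⁿ) :
    fderiv ℝ (inChart p φ) y v =
      mfderiv (𝓡 n) 𝓘(ℝ, ℝ) φ ((chart p).symm y) (frame p y v) := by
  have hchain := mfderiv_comp (I := 𝓡 n) (I' := 𝓡 n) (I'' := 𝓘(ℝ, ℝ)) y
    (hφ ((chart p).symm y)) (mdifferentiableAt_chart_symm hy)
  exact DFunLike.congr_fun ((mfderiv_eq_fderiv (f := inChart p φ)).symm.trans hchain) v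

theorem eq_sum_vecComponent_smul_frame (X : ∀ x : M, TangentSpace (𝓡 n) x) {p : M} {y : ℝⁿ}
    (hy : y ∈ (chart p).target) :
    X ((chart p).symm y) =
      ∑ j, vecComponent X p j y • frame p y (EuclideanSpace.single j (1 : ℝ)) := by
  have hbasis := (EuclideanSpace.basisFun (Fin n) ℝ).sum_repr
    (coframe p ((chart p).symm y) (X ((chart p).symm y)))
  simp only [EuclideanSpace.basisFun_repr, EuclideanSpace.basisFun_apply] at hbasis
  have hframe := frame_coframe_symm hy (X ((chart p).symm y))
  rw [← hbasis, map_sum] at hframe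
  simp only [map_smul] at hframe
  exact hframe.symm

theorem dirDeriv_eq_sum {p : M} {y : ℝⁿ} (hy : y ∈ (chart p).target) {φ : M → ℝ}
    (hφ : MDifferentiable (𝓡 n) 𝓘(ℝ, ℝ) φ) (X : ∀ x : M, TangentSpace (𝓡 n) x) :
    dirDeriv φ X ((chart p).symm y) = ∑ j,
      fderiv ℝ (inChart p φ) y (EuclideanSpace.single j 1) * vecComponent X p j y := by
  simp only [fderiv_inChart hy hφ, dirDeriv]
  rw [eq_sum_vecComponent_smul_frame X hy]
  refine (map_sum (mfderiv (𝓡 n) 𝓘(ℝ, ℝ) φ ((chart p).symm y)) _ _).trans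
    (Finset.sum_congr rfl fun j _ ↦ ?_)
  exact (map_smul (mfderiv (𝓡 n) 𝓘(ℝ, ℝ) φ ((chart p).symm y)) _ _).trans
    (mul_comm (vecComponent X p j y) _)

end Frames

section VectorFields

theorem dirDeriv_smul (φ f : M → ℝ) (X : ∀ x : M, TangentSpace (𝓡 n) x) (x : M) :
    dirDeriv φ (fun x ↦ f x • X x) x = f x * dirDeriv φ X x :=
  (mfderiv (𝓡 n) 𝓘(ℝ, ℝ) φ x).map_smul (f x) (X x)

theorem dirDeriv_mul {φ ψ : M → ℝ} {x : M} (hφ : MDifferentiableAt (𝓡 n) 𝓘(ℝ, ℝ) φ x)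
    (hψ : MDifferentiableAt (𝓡 n) 𝓘(ℝ, ℝ) ψ x) (X : ∀ x : M, TangentSpace (𝓡 n) x) :
    dirDeriv (fun x ↦ φ x * ψ x) X x = φ x * dirDeriv ψ X x + ψ x * dirDeriv φ X x :=
  DFunLike.congr_fun (hφ.hasMFDerivAt.mul hψ.hasMFDerivAt).mfderiv (X x)

theorem dirDeriv_add {φ ψ : M → ℝ} {x : M} (hφ : MDifferentiableAt (𝓡 n) 𝓘(ℝ, ℝ) φ x)
    (hψ : MDifferentiableAt (𝓡 n) 𝓘(ℝ, ℝ) ψ x) (X : ∀ x : M, TangentSpace (𝓡 n) x) :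
    dirDeriv (φ + ψ) X x = dirDeriv φ X x + dirDeriv ψ X x :=
  DFunLike.congr_fun (mfderiv_add hφ hψ) (X x)

theorem dirDeriv_const (r : ℝ) (X : ∀ x : M, TangentSpace (𝓡 n) x) (x : M) :
    dirDeriv (fun _ ↦ r) X x = 0 :=
  DFunLike.congr_fun (mfderiv_const (c := r)) (X x)

theorem dirDeriv_sum {ι : Type*} {s : Finset ι} {φ : ι → M → ℝ} {x : M}
    (hφ : ∀ i ∈ s, MDifferentiableAt (𝓡 n) 𝓘(ℝ, ℝ) (φ i) x)
    (X : ∀ x : M, TangentSpace (𝓡 n) x) :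
    dirDeriv (∑ i ∈ s, φ i) X x = ∑ i ∈ s, dirDeriv (φ i) X x := by
  classical
  suffices h : MDifferentiableAt (𝓡 n) 𝓘(ℝ, ℝ) (∑ i ∈ s, φ i) x ∧
      dirDeriv (∑ i ∈ s, φ i) X x = ∑ i ∈ s, dirDeriv (φ i) X x from h.2
  induction s using Finset.induction_on with
  | empty => exact ⟨mdifferentiableAt_const, dirDeriv_const 0 X x⟩
  | insert i s hi ih =>
    obtain ⟨hdiff, heq⟩ := ih fun j hj ↦ hφ j (Finset.mem_insert_of_mem hj)
    have hφi := hφ i (s.mem_insert_self i)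
    simp only [Finset.sum_insert hi]
    exact ⟨hφi.add hdiff, by rw [dirDeriv_add hφi hdiff, heq]⟩

theorem dirDeriv_comp {g : ℝ → ℝ} {g' : ℝ} {φ : M → ℝ} {x : M}
    (hg : HasDerivAt g g' (φ x)) (hφ : MDifferentiableAt (𝓡 n) 𝓘(ℝ, ℝ) φ x)
    (X : ∀ x : M, TangentSpace (𝓡 n) x) :
    dirDeriv (fun x ↦ g (φ x)) X x = g' * dirDeriv φ X x := by
  have hcomp := (hg.hasFDerivAt.hasMFDerivAt.comp x hφ.hasMFDerivAt).mfderiv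
  exact (DFunLike.congr_fun hcomp (X x)).trans (mul_comm (dirDeriv φ X x) g')

variable [IsManifold (𝓡 n) ∞ M]

theorem contMDiffOn_coordVec (p : M) (j : Fin n) :
    ContMDiffOn (𝓡 n) (𝓡 n).tangent ∞
      (fun y ↦ (⟨(chart p).symm y, coordVec p y j⟩ : TangentBundle (𝓡 n) M)) (chart p).target := by
  have : IsManifold (𝓡 n) 1 M := .of_le (n := ∞) (by simp)
  have ho := (chart p).open_target
  have hsymm := (contMDiffOn_chart_symm (I := 𝓡 n) (n := ∞) (x := p)).contMDiffOn_tangentMapWithin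
    (m := ∞) le_rfl ho.uniqueMDiffOn
  have hsingle : ContMDiff (𝓡 n) (𝓡 n).tangent ∞ (fun y : ℝⁿ ↦
      (⟨y, EuclideanSpace.single j (1 : ℝ)⟩ : TangentBundle (𝓡 n) ℝⁿ)) :=
    contMDiff_vectorSpace_iff_contDiff.2
      (contDiff_const (c := (EuclideanSpace.single j (1 : ℝ) : ℝⁿ)))
  refine (hsymm.comp hsingle.contMDiffOn fun y hy ↦ hy).congr fun y hy ↦ ?_
  simp only [Function.comp, tangentMapWithin, mfderivWithin_of_isOpen ho hy]
  rfl

theorem contMDiff_iff_contMDiffOn_coframe {m : WithTop ℕ∞} (hm : m ≤ (∞ : WithTop ℕ∞))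
    {X : ∀ x : M, TangentSpace (𝓡 n) x} :
    ContMDiff (𝓡 n) (𝓡 n).tangent m (fun x ↦ (⟨x, X x⟩ : TangentBundle (𝓡 n) M)) ↔
      ∀ p, ContMDiffOn (𝓡 n) 𝓘(ℝ, ℝⁿ) m (fun x ↦ coframe p x (X x)) (chart p).source := by
  have : IsManifold (𝓡 n) 1 M := .of_le (n := ∞) (by simp)
  have : IsManifold (𝓡 n) (m + 1) M := .of_le (n := ∞) (add_le_add hm le_rfl)
  have : ContMDiffVectorBundle m ℝⁿ (TangentSpace (𝓡 n) : M → Type _) (𝓡 n) :=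
    TangentBundle.contMDiffVectorBundle
  have hp (p : M) : ContMDiffOn (𝓡 n) (𝓡 n).tangent m
      (fun x ↦ (⟨x, X x⟩ : TangentBundle (𝓡 n) M)) (chart p).source ↔
      ContMDiffOn (𝓡 n) 𝓘(ℝ, ℝⁿ) m (fun x ↦ coframe p x (X x)) (chart p).source := by
    refine ((trivializationAt ℝⁿ (TangentSpace (𝓡 n)) p).contMDiffOn_section_baseSet_iff
      (IB := 𝓡 n) (n := m) (s := X)).trans (contMDiffOn_congr fun x hx ↦ ?_)
    have hder := TangentBundle.continuousLinearMapAt_trivializationAt (I := 𝓡 n) hx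
    rw [← Trivialization.continuousLinearMapAt_apply_of_mem (R := ℝ) _ hx, hder]
    rfl
  refine ⟨fun h p ↦ (hp p).1 h.contMDiffOn, fun h x ↦ ?_⟩
  exact ((hp x).2 (h x)).contMDiffAt
    ((chart x).open_source.mem_nhds (mem_chart_source ℝⁿ x))

theorem contMDiff_iff_contDiffOn_vecComponent {m : WithTop ℕ∞} (hm : m ≤ (∞ : WithTop ℕ∞))
    {X : ∀ x : M, TangentSpace (𝓡 n) x} :
    ContMDiff (𝓡 n) (𝓡 n).tangent m (fun x ↦ (⟨x, X x⟩ : TangentBundle (𝓡 n) M)) ↔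
      ∀ p j, ContDiffOn ℝ m (vecComponent X p j) (chart p).target := by
  have : IsManifold (𝓡 n) m M := .of_le hm
  rw [contMDiff_iff_contMDiffOn_coframe hm]
  refine forall_congr' fun p ↦ ?_
  have himage : (chart p).extend (𝓡 n) '' (chart p).source = (chart p).target :=
    (chart p).image_source_eq_target
  rw [contMDiffOn_iff_source_of_mem_maximalAtlas (IsManifold.chart_mem_maximalAtlas p) subset_rfl,
    himage, contMDiffOn_iff_contDiffOn]
  exact contDiffOn_euclidean

theorem contMDiff_smul_vectorField {m : WithTop ℕ∞} (hm : m ≤ (∞ : WithTop ℕ∞)) {φ : M → ℝ}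
    {X : ∀ x : M, TangentSpace (𝓡 n) x} (hφ : ContMDiff (𝓡 n) 𝓘(ℝ, ℝ) m φ)
    (hX : ContMDiff (𝓡 n) (𝓡 n).tangent m fun x ↦ (⟨x, X x⟩ : TangentBundle (𝓡 n) M)) :
    ContMDiff (𝓡 n) (𝓡 n).tangent m fun x ↦ (⟨x, φ x • X x⟩ : TangentBundle (𝓡 n) M) := by
  have : IsManifold (𝓡 n) 1 M := .of_le (n := ∞) (by simp)
  have : IsManifold (𝓡 n) (m + 1) M := .of_le (n := ∞) (add_le_add hm le_rfl)
  have : ContMDiffVectorBundle m ℝⁿ (TangentSpace (𝓡 n) : M → Type _) (𝓡 n) :=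
    TangentBundle.contMDiffVectorBundle
  exact hφ.smul_section hX

theorem continuous_dirDeriv {φ : M → ℝ} (hφ : ContMDiff (𝓡 n) 𝓘(ℝ, ℝ) 1 φ)
    {X : ∀ x : M, TangentSpace (𝓡 n) x}
    (hX : Continuous (fun x ↦ (⟨x, X x⟩ : TangentBundle (𝓡 n) M))) :
    Continuous (dirDeriv φ X) := by
  have : IsManifold (𝓡 n) 1 M := .of_le (n := ∞) (by simp)
  exact (contMDiff_snd_tangentBundle_modelSpace (n := 0) ℝ 𝓘(ℝ, ℝ)).continuous.comp
    ((hφ.continuous_tangentMap le_rfl).comp hX)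

end VectorFields

section MatrixSmoothness

variable {ι E : Type*} [Fintype ι] [DecidableEq ι] [NormedAddCommGroup E] [NormedSpace ℝ E]
  {m : WithTop ℕ∞} {s : Set E} {A : E → Matrix ι ι ℝ}

theorem contDiffOn_matrix_det
    (hA : ∀ i j, ContDiffOn ℝ m (fun y ↦ A y i j) s) : ContDiffOn ℝ m (fun y ↦ (A y).det) s := by
  simp only [Matrix.det_apply']
  exact ContDiffOn.sum fun σ _ ↦ contDiffOn_const.mul (contDiffOn_prod fun i _ ↦ hA _ _)

theorem contDiffOn_matrix_inv_apply
    (hA : ∀ i j, ContDiffOn ℝ m (fun y ↦ A y i j) s) (hdet : ∀ y ∈ s, (A y).det ≠ 0) (i j : ι) :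
    ContDiffOn ℝ m (fun y ↦ (A y)⁻¹ i j) s := by
  simp only [Matrix.inv_def, Ring.inverse_eq_inv', Matrix.smul_apply, smul_eq_mul,
    Matrix.adjugate_apply]
  refine ((contDiffOn_matrix_det hA).inv hdet).mul (contDiffOn_matrix_det fun k l ↦ ?_)
  simp only [Matrix.updateRow_apply]
  split_ifs
  exacts [contDiffOn_const, hA k l]

end MatrixSmoothness

section Metric

variable [RiemannianBundle (fun x : M ↦ TangentSpace (𝓡 n) x)]

/-- The inner product of the tangent space at `x`, as a bilinear form on the model space. -/
def metric (x : M) : LinearMap.BilinForm ℝ ℝⁿ :=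
  innerₗ (TangentSpace (𝓡 n) x)

theorem gramMatrix_eq_toMatrix (p : M) (y : ℝⁿ) :
    gramMatrix p y = LinearMap.BilinForm.toMatrix (EuclideanSpace.basisFun (Fin n) ℝ).toBasis
      ((metric ((chart p).symm y)).comp (frame p y).toLinearMap (frame p y).toLinearMap) := by
  ext j k
  simp only [LinearMap.BilinForm.toMatrix_apply, LinearMap.BilinForm.comp_apply,
    OrthonormalBasis.coe_toBasis, EuclideanSpace.basisFun_apply]
  rfl

theorem inner_grad_left (u : M → ℝ) (X : ∀ x : M, TangentSpace (𝓡 n) x) (x : M) :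
    inner ℝ (grad u x) (X x) = dirDeriv u X x := by
  have : FiniteDimensional ℝ (TangentSpace (𝓡 n) x) :=
    inferInstanceAs (FiniteDimensional ℝ ℝⁿ)
  have : CompleteSpace (TangentSpace (𝓡 n) x) := FiniteDimensional.complete ℝ _
  exact InnerProductSpace.toDual_symm_apply

variable [IsManifold (𝓡 n) ∞ M]

theorem gramMatrix_transition {p q : M} {y : ℝⁿ} (hy : y ∈ (transition p q).source) :
    let J := LinearMap.toMatrix (EuclideanSpace.basisFun (Fin n) ℝ).toBasis
      (EuclideanSpace.basisFun (Fin n) ℝ).toBasis (fderiv ℝ (transition p q) y).toLinearMap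
    gramMatrix p y = J.transpose * gramMatrix q (transition p q y) * J := by
  intro J
  have hx : (chart q).symm (transition p q y) = (chart p).symm y :=
    (chart q).left_inv (mem_transition_source.1 hy).2
  rw [gramMatrix_eq_toMatrix, gramMatrix_eq_toMatrix, hx, frame_eq_comp_fderiv_transition hy,
    ← LinearMap.BilinForm.toMatrix_comp]
  rfl

theorem volDensity_transition {p q : M} {y : ℝⁿ} (hy : y ∈ (transition p q).source) :
    volDensity p y = |(fderiv ℝ (transition p q) y).det| * volDensity q (transition p q y) := by
  rw [volDensity, gramMatrix_transition hy, Matrix.det_mul, Matrix.det_mul,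
    Matrix.det_transpose, LinearMap.det_toMatrix, mul_right_comm, ← pow_two,
    Real.sqrt_mul (sq_nonneg _), Real.sqrt_sq_eq_abs, volDensity, ContinuousLinearMap.det]

theorem gramMatrix_det_pos {p : M} {y : ℝⁿ} (hy : y ∈ (chart p).target) :
    0 < (gramMatrix p y).det := by
  have hker : (frame p y).toLinearMap.ker = ⊥ := LinearMap.ker_eq_bot.2
    (Function.LeftInverse.injective (coframe_frame hy))
  have hindep : LinearIndependent ℝ (coordVec p y) := by
    have hmap := (EuclideanSpace.basisFun (Fin n) ℝ).toBasis.linearIndependent.map' _ hker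
    simp only [Function.comp_def, OrthonormalBasis.coe_toBasis, EuclideanSpace.basisFun_apply]
      at hmap
    exact hmap
  exact (Matrix.posDef_gram_iff_linearIndependent.2 hindep).det_pos

theorem volDensity_pos {p : M} {y : ℝⁿ} (hy : y ∈ (chart p).target) : 0 < volDensity p y :=
  Real.sqrt_pos.2 (gramMatrix_det_pos hy)

theorem vecComponent_grad {p : M} {y : ℝⁿ} (hy : y ∈ (chart p).target) {u : M → ℝ}
    (hu : MDifferentiable (𝓡 n) 𝓘(ℝ, ℝ) u) (j : Fin n) :
    vecComponent (grad u) p j y =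
      ∑ k, fderiv ℝ (inChart p u) y (EuclideanSpace.single k 1) * (gramMatrix p y)⁻¹ k j := by
  have hmul : Matrix.vecMul (fun i ↦ vecComponent (grad u) p i y) (gramMatrix p y) =
      fun k ↦ fderiv ℝ (inChart p u) y (EuclideanSpace.single k 1) := by
    ext k
    have hgrad := inner_grad_left u (fun _ ↦ frame p y (EuclideanSpace.single k (1 : ℝ)))
      ((chart p).symm y)
    change metric _ (grad u _) _ = _ at hgrad
    rw [eq_sum_vecComponent_smul_frame (grad u) hy, map_sum, LinearMap.sum_apply] at hgrad
    simp only [map_smul, LinearMap.smul_apply] at hgrad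
    exact hgrad.trans (fderiv_inChart hy hu _).symm
  have hinv := congrArg (Matrix.vecMul · (gramMatrix p y)⁻¹) hmul
  simp only [Matrix.vecMul_vecMul, Matrix.mul_nonsing_inv _ (gramMatrix_det_pos hy).ne'.isUnit,
    Matrix.vecMul_one] at hinv
  exact congrFun hinv j

variable [IsContMDiffRiemannianBundle (𝓡 n) ∞ (EuclideanSpace ℝ (Fin n))
  (fun x : M ↦ TangentSpace (𝓡 n) x)]

theorem contDiffOn_gramMatrix_apply (p : M) (j k : Fin n) :
    ContDiffOn ℝ ∞ (fun y ↦ gramMatrix p y j k) (chart p).target := by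
  rw [← contMDiffOn_iff_contDiffOn]
  exact (contMDiffOn_coordVec p j).inner_bundle (contMDiffOn_coordVec p k)

theorem contDiffOn_volDensity (p : M) : ContDiffOn ℝ ∞ (volDensity p) (chart p).target :=
  (contDiffOn_matrix_det (contDiffOn_gramMatrix_apply p)).sqrt
    fun _ hy ↦ (gramMatrix_det_pos hy).ne'

theorem contMDiff_grad {m : WithTop ℕ∞} (hm : m + 1 ≤ (∞ : WithTop ℕ∞)) {u : M → ℝ}
    (hu : ContMDiff (𝓡 n) 𝓘(ℝ, ℝ) (m + 1) u) :
    ContMDiff (𝓡 n) (𝓡 n).tangent m (fun x ↦ (⟨x, grad u x⟩ : TangentBundle (𝓡 n) M)) := by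
  have hm' : m ≤ (∞ : WithTop ℕ∞) := le_self_add.trans hm
  rw [contMDiff_iff_contDiffOn_vecComponent hm']
  intro p j
  refine (ContDiffOn.sum fun k _ ↦ ?_).congr
    fun y hy ↦ vecComponent_grad hy (hu.mdifferentiable (by simp)) j
  have hpartial := (contDiffOn_inChart hm p hu).fderiv_of_isOpen (chart p).open_target le_rfl
  exact (hpartial.clm_apply contDiffOn_const).mul ((contDiffOn_matrix_inv_apply
    (contDiffOn_gramMatrix_apply p) (fun y hy ↦ (gramMatrix_det_pos hy).ne') k j).of_le hm')

end Metric

section Partition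

variable [IsManifold (𝓡 n) ∞ M] [T2Space M] [CompactSpace M]

variable (n M) in
/-- The partition of unity subordinate to the chart domains used in `riemannianVolume`. -/
def chartPartition : SmoothPartitionOfUnity M (𝓡 n) M :=
  (SmoothPartitionOfUnity.exists_isSubordinate_chartAt_source (𝓡 n) M).choose

theorem tsupport_chartPartition_subset (p : M) :
    tsupport (chartPartition n M p) ⊆ (chart p).source :=
  (SmoothPartitionOfUnity.exists_isSubordinate_chartAt_source (𝓡 n) M).choose_spec p

variable (n M) in
/-- The finite set of indices of the nonzero functions of `chartPartition`. -/
def chartPartitionIndices : Finset M :=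
  (chartPartition n M).locallyFinite.finite_nonempty_of_compact.toFinset

theorem chartPartition_eq_zero {p : M} (hp : p ∉ chartPartitionIndices n M) (x : M) :
    chartPartition n M p x = 0 := by
  by_contra h
  exact hp ((Set.Finite.mem_toFinset _).2 ⟨x, h⟩)

theorem sum_chartPartition (x : M) :
    ∑ p ∈ chartPartitionIndices n M, chartPartition n M p x = 1 := by
  rw [← (chartPartition n M).sum_eq_one (Set.mem_univ x)]
  refine (finsum_eq_sum_of_support_subset _ fun p hp ↦ ?_).symm
  by_contra h
  exact hp (chartPartition_eq_zero h x)

end Partition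

section Volume

theorem measurableSet_chart_image [MeasurableSpace M] [BorelSpace M] {p : M} {A : Set M}
    (hA : MeasurableSet A) (hAp : A ⊆ (chart p).source) : MeasurableSet (chart p '' A) := by
  rw [OpenPartialHomeomorph.image_eq_target_inter_inv_preimage _ hAp, ← Subtype.image_preimage_coe]
  exact (chart p).open_target.measurableSet.subtype_image
    ((chart p).continuousOn_symm.domRestrict.measurable hA)

variable [RiemannianBundle (fun x : M ↦ TangentSpace (𝓡 n) x)] [MeasurableSpace M] [BorelSpace M]

theorem aemeasurable_chart_symm (p : M) :
    AEMeasurable (chart p).symm ((volume.restrict (chart p).target).withDensity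
      fun y ↦ ENNReal.ofReal (volDensity p y)) :=
  ((chart p).continuousOn_symm.aemeasurable (chart p).open_target.measurableSet).mono_ac
    (withDensity_absolutelyContinuous _ _)

theorem chartVolume_apply {p : M} {A : Set M} (hA : MeasurableSet A) (hAp : A ⊆ (chart p).source) :
    chartVolume (n := n) p A = ∫⁻ y in chart p '' A, ENNReal.ofReal (volDensity p y) := by
  rw [chartVolume, Measure.map_apply_of_aemeasurable (aemeasurable_chart_symm p) hA,
    withDensity_apply', Measure.restrict_restrict' (chart p).open_target.measurableSet,
    OpenPartialHomeomorph.image_eq_target_inter_inv_preimage _ hAp, Set.inter_comm]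

theorem chartVolume_restrict_source (p : M) :
    (chartVolume (n := n) p).restrict (chart p).source = chartVolume (n := n) p := by
  refine Measure.restrict_eq_self_of_ae_mem ?_
  refine (ae_map_iff (aemeasurable_chart_symm p) (chart p).open_source.measurableSet).2 ?_
  exact withDensity_absolutelyContinuous _ _ ((ae_restrict_mem
    (chart p).open_target.measurableSet).mono fun y hy ↦ (chart p).map_target hy)

section Gluing

variable [IsManifold (𝓡 n) ∞ M]

theorem chartVolume_eq_of_subset {p q : M} {A : Set M} (hA : MeasurableSet A)
    (hAp : A ⊆ (chart p).source) (hAq : A ⊆ (chart q).source) :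
    chartVolume (n := n) p A = chartVolume (n := n) q A := by
  have hsub : chart p '' A ⊆ (transition p q).source := by
    rintro _ ⟨x, hx, rfl⟩
    rw [mem_transition_source, (chart p).left_inv (hAp hx)]
    exact ⟨(chart p).map_source (hAp hx), hAq hx⟩
  have himage : chart q '' A = transition p q '' (chart p '' A) := by
    rw [Set.image_image]
    exact Set.image_congr fun x hx ↦ congrArg (chart q) ((chart p).left_inv (hAp hx)).symm
  rw [chartVolume_apply hA hAp, chartVolume_apply hA hAq, himage,
    lintegral_image_eq_lintegral_abs_det_fderiv_mul volume (measurableSet_chart_image hA hAp)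
      (fun y hy ↦ (hasFDerivAt_transition (hsub hy)).hasFDerivWithinAt)
      ((transition p q).injOn.mono hsub)]
  refine setLIntegral_congr_fun (measurableSet_chart_image hA hAp) fun y hy ↦ ?_
  rw [← ENNReal.ofReal_mul (abs_nonneg _), ← volDensity_transition (hsub hy)]

theorem chartVolume_restrict_comm (p q : M) :
    (chartVolume (n := n) p).restrict (chart q).source =
      (chartVolume (n := n) q).restrict (chart p).source := by
  have hp := (chart p).open_source.measurableSet
  have hq := (chart q).open_source.measurableSet
  rw [← chartVolume_restrict_source p, ← chartVolume_restrict_source q,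
    Measure.restrict_restrict hp, Measure.restrict_restrict hq, Set.inter_comm]
  ext A hA
  rw [Measure.restrict_apply hA, Measure.restrict_apply hA]
  exact chartVolume_eq_of_subset (hA.inter (hp.inter hq)) (fun x hx ↦ hx.2.1) fun x hx ↦ hx.2.2

theorem withDensity_chartVolume_restrict_source (p q : M) {f : M → ℝ≥0∞}
    (hf : f.support ⊆ (chart p).source) :
    ((chartVolume (n := n) p).withDensity f).restrict (chart q).source =
      (chartVolume (n := n) q).withDensity f := by
  rw [restrict_withDensity (chart q).open_source.measurableSet, chartVolume_restrict_comm,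
    ← withDensity_indicator (chart p).open_source.measurableSet, Set.indicator_eq_self.2 hf]

variable [T2Space M] [CompactSpace M]

theorem riemannianVolume_restrict_source (q : M) :
    (riemannianVolume n M).restrict (chart q).source = chartVolume (n := n) q := by
  let ρ (p x : M) : ℝ≥0∞ := ENNReal.ofReal (chartPartition n M p x)
  have hρ (p : M) : (ρ p).support ⊆ (chart p).source := fun x hx ↦
    tsupport_chartPartition_subset p (subset_tsupport _ fun h0 ↦ hx (by simp [ρ, h0]))
  have hsum (x : M) : ∑ p ∈ chartPartitionIndices n M, ρ p x = 1 := by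
    rw [← ENNReal.ofReal_sum_of_nonneg fun p _ ↦ (chartPartition n M).nonneg p x,
      sum_chartPartition, ENNReal.ofReal_one]
  calc (riemannianVolume n M).restrict (chart q).source
      = Measure.sum fun p ↦ (chartVolume q).withDensity (ρ p) := by
        rw [riemannianVolume, Measure.restrict_sum _ (chart q).open_source.measurableSet]
        exact congrArg Measure.sum
          (funext fun p ↦ withDensity_chartVolume_restrict_source p q (hρ p))
    _ = chartVolume q := by
        ext A hA
        simp only [Measure.sum_apply _ hA, withDensity_apply _ hA]
        rw [tsum_eq_sum (s := chartPartitionIndices n M)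
          fun p hp ↦ by simp [ρ, chartPartition_eq_zero hp], ← lintegral_finsetSum _ fun p _ ↦
          (chartPartition n M p).contMDiff.continuous.measurable.ennreal_ofReal]
        rw [lintegral_congr hsum, lintegral_one, Measure.restrict_apply_univ]

theorem riemannianVolume_apply {q : M} {A : Set M} (hA : MeasurableSet A)
    (hAq : A ⊆ (chart q).source) :
    riemannianVolume n M A = ∫⁻ y in chart q '' A, ENNReal.ofReal (volDensity q y) := by
  rw [← Measure.restrict_eq_self _ hAq, riemannianVolume_restrict_source,
    chartVolume_apply hA hAq]

end Gluing

variable [IsManifold (𝓡 n) ∞ M] [T2Space M] [CompactSpace M]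
  [IsContMDiffRiemannianBundle (𝓡 n) ∞ (EuclideanSpace ℝ (Fin n))
    (fun x : M ↦ TangentSpace (𝓡 n) x)]

instance isFiniteMeasure_riemannianVolume : IsFiniteMeasure (riemannianVolume n M) := by
  have : IsLocallyFiniteMeasure (riemannianVolume n M) := by
    refine ⟨fun x ↦ ?_⟩
    obtain ⟨K, hK, hKx, hKc⟩ := local_compact_nhds
      ((chart x).open_source.mem_nhds (mem_chart_source ℝⁿ x))
    refine ⟨K, hK, ?_⟩
    rw [riemannianVolume_apply hKc.measurableSet hKx]
    exact (ContinuousOn.integrableOn_compact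
      (hKc.image_of_continuousOn ((chart x).continuousOn.mono hKx))
      ((contDiffOn_volDensity x).continuousOn.mono
        ((chart x).mapsTo.mono_left hKx).image_subset)).setLIntegral_lt_top
  infer_instance

instance isOpenPosMeasure_riemannianVolume : (riemannianVolume n M).IsOpenPosMeasure := by
  refine ⟨fun U hU ⟨x, hx⟩ hzero ↦ ?_⟩
  let V := U ∩ (chart x).source
  have hV : IsOpen V := hU.inter (chart x).open_source
  have himage : IsOpen (chart x '' V) :=
    (chart x).isOpen_image_of_subset_source hV Set.inter_subset_right
  have htarget : chart x '' V ⊆ (chart x).target :=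
    ((chart x).mapsTo.mono_left Set.inter_subset_right).image_subset
  have hdensity : ∫⁻ y in chart x '' V, ENNReal.ofReal (volDensity x y) = 0 := by
    rw [← riemannianVolume_apply hV.measurableSet Set.inter_subset_right]
    exact measure_mono_null Set.inter_subset_left hzero
  have hnull : volume (chart x '' V) = 0 := by
    have hpos : volume.restrict (chart x '' V) {y | ENNReal.ofReal (volDensity x y) ≠ 0} = 0 := by
      rwa [lintegral_eq_zero_iff' (((contDiffOn_volDensity x).continuousOn.mono
        htarget).aemeasurable himage.measurableSet).ennreal_ofReal] at hdensity
    rw [← Measure.restrict_apply_self]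
    refine measure_mono_null (fun y hy ↦ ?_) hpos
    exact (ENNReal.ofReal_pos.2 (volDensity_pos (htarget hy))).ne'
  exact himage.measure_ne_zero volume ⟨_, x, ⟨hx, mem_chart_source ℝⁿ x⟩, rfl⟩ hnull

theorem integrable_riemannianVolume_of_continuous {f : M → ℝ} (hf : Continuous f) :
    Integrable f (riemannianVolume n M) :=
  hf.integrable_of_hasCompactSupport (.of_compactSpace f)

theorem setIntegral_chart_source {q : M} {f : M → ℝ} (hf : ContinuousOn f (chart q).source) :
    ∫ x in (chart q).source, f x ∂(riemannianVolume n M) =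
      ∫ y in (chart q).target, volDensity q y * f ((chart q).symm y) := by
  have hmeas : AEStronglyMeasurable f (chartVolume (n := n) q) := by
    rw [← chartVolume_restrict_source]
    exact hf.aestronglyMeasurable (chart q).open_source.measurableSet
  have hdensity : AEMeasurable (volDensity q) (volume.restrict (chart q).target) :=
    (contDiffOn_volDensity q).continuousOn.aemeasurable (chart q).open_target.measurableSet
  rw [riemannianVolume_restrict_source]
  rw [chartVolume] at hmeas ⊢
  rw [integral_map (aemeasurable_chart_symm q) hmeas, integral_withDensity_eq_integral_toReal_smul₀
    hdensity.ennreal_ofReal (ae_of_all _ fun _ ↦ ENNReal.ofReal_lt_top)]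
  exact setIntegral_congr_fun (chart q).open_target.measurableSet fun y hy ↦
    congrArg (· * _) (ENNReal.toReal_ofReal (volDensity_pos hy).le)

end Volume

section ZeroExtension

variable {E : Type*} [NormedAddCommGroup E] {U K : Set E} {F : E → ℝ}

theorem indicator_eventuallyEq (hU : IsOpen U) {y : E} (hy : y ∈ U) : U.indicator F =ᶠ[𝓝 y] F :=
  Set.eqOn_indicator.eventuallyEq_of_mem (hU.mem_nhds hy)

theorem indicator_eventuallyEq_zero (hK : IsClosed K) (hFK : ∀ y ∈ U \ K, F y = 0) {y : E}
    (hy : y ∉ K) : U.indicator F =ᶠ[𝓝 y] 0 := by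
  filter_upwards [hK.isOpen_compl.mem_nhds hy] with z hz
  exact Set.indicator_apply_eq_zero.2 fun hzU ↦ hFK z ⟨hzU, hz⟩

theorem hasCompactSupport_indicator (hK : IsCompact K) (hFK : ∀ y ∈ U \ K, F y = 0) :
    HasCompactSupport (U.indicator F) :=
  .intro hK fun y hy ↦ Set.indicator_apply_eq_zero.2 fun hyU ↦ hFK y ⟨hyU, hy⟩

variable [NormedSpace ℝ E]

theorem contDiff_indicator {m : WithTop ℕ∞} (hU : IsOpen U) (hK : IsClosed K) (hKU : K ⊆ U)
    (hF : ContDiffOn ℝ m F U) (hFK : ∀ y ∈ U \ K, F y = 0) : ContDiff ℝ m (U.indicator F) := by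
  refine contDiff_iff_contDiffAt.2 fun y ↦ ?_
  by_cases hy : y ∈ U
  · exact (hF.contDiffAt (hU.mem_nhds hy)).congr_of_eventuallyEq (indicator_eventuallyEq hU hy)
  · exact contDiffAt_const.congr_of_eventuallyEq
      (indicator_eventuallyEq_zero hK hFK fun h ↦ hy (hKU h))

theorem fderiv_indicator (hU : IsOpen U) (hK : IsClosed K) (hKU : K ⊆ U)
    (hFK : ∀ y ∈ U \ K, F y = 0) : fderiv ℝ (U.indicator F) = U.indicator (fderiv ℝ F) := by
  ext1 y
  by_cases hy : y ∈ U
  · rw [(indicator_eventuallyEq hU hy).fderiv_eq, Set.indicator_of_mem hy]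
  · rw [(indicator_eventuallyEq_zero hK hFK fun h ↦ hy (hKU h)).fderiv_eq,
      Set.indicator_of_notMem hy, fderiv_zero, Pi.zero_apply]

variable [MeasurableSpace E] [BorelSpace E] (μ : Measure E)

theorem integrableOn_fderiv_apply [IsFiniteMeasureOnCompacts μ] (hU : IsOpen U)
    (hK : IsCompact K) (hKU : K ⊆ U) (hF : ContDiffOn ℝ 1 F U) (hFK : ∀ y ∈ U \ K, F y = 0)
    (v : E) :
    IntegrableOn (fun y ↦ fderiv ℝ F y v) U μ := by
  have hderiv : Continuous fun y ↦ fderiv ℝ (U.indicator F) y v :=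
    ((contDiff_indicator hU hK.isClosed hKU hF hFK).continuous_fderiv
      one_ne_zero).clm_apply continuous_const
  refine IntegrableOn.congr_fun (hderiv.integrable_of_hasCompactSupport
    ((hasCompactSupport_indicator hK hFK).fderiv_apply (𝕜 := ℝ) v)).integrableOn
    (fun y hy ↦ ?_) hU.measurableSet
  simp only [fderiv_indicator hU hK.isClosed hKU hFK, Set.indicator_of_mem hy]

variable [FiniteDimensional ℝ E] [μ.IsAddHaarMeasure]

theorem integral_fderiv_apply_eq_zero {G : E → ℝ} (hG : ContDiff ℝ 1 G)
    (hGc : HasCompactSupport G) (v : E) : ∫ y, fderiv ℝ G y v ∂μ = 0 := by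
  have hderiv : Continuous fun y ↦ fderiv ℝ G y v :=
    (hG.continuous_fderiv one_ne_zero).clm_apply continuous_const
  have hparts := integral_mul_fderiv_eq_neg_fderiv_mul_of_integrable (μ := μ) (f := fun _ ↦ (1 : ℝ))
    (g := G) (v := v) (by simp)
    (by simpa using hderiv.integrable_of_hasCompactSupport (hGc.fderiv_apply (𝕜 := ℝ) v))
    (by simpa using hG.continuous.integrable_of_hasCompactSupport hGc)
    (fun _ _ ↦ differentiableAt_const _) (fun y _ ↦ hG.differentiable one_ne_zero y)
  simpa using hparts

theorem setIntegral_fderiv_apply_eq_zero (hU : IsOpen U)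
    (hK : IsCompact K) (hKU : K ⊆ U) (hF : ContDiffOn ℝ 1 F U) (hFK : ∀ y ∈ U \ K, F y = 0)
    (v : E) :
    ∫ y in U, fderiv ℝ F y v ∂μ = 0 := by
  rw [← integral_fderiv_apply_eq_zero μ (contDiff_indicator hU hK.isClosed hKU hF hFK)
      (hasCompactSupport_indicator hK hFK) v,
    fderiv_indicator hU hK.isClosed hKU hFK, ← integral_indicator hU.measurableSet]
  exact integral_congr_ae (ae_of_all _ fun y ↦ by by_cases hy : y ∈ U <;> simp [hy])

end ZeroExtension

section Divergence

theorem dirDeriv_eq_zero_of_notMem_tsupport {φ : M → ℝ} {x : M} (hx : x ∉ tsupport φ)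
    (X : ∀ x : M, TangentSpace (𝓡 n) x) : dirDeriv φ X x = 0 := by
  have hzero : φ =ᶠ[𝓝 x] fun _ ↦ 0 := notMem_tsupport_iff_eventuallyEq.1 hx
  have hderiv : dirDeriv φ X x = dirDeriv (fun _ ↦ 0) X x :=
    DFunLike.congr_fun (hzero.mfderiv_eq (I := 𝓡 n) (I' := 𝓘(ℝ, ℝ))) (X x)
  rw [hderiv, dirDeriv_const]

theorem continuous_mul_of_tsupport_subset {Y : Type*} [TopologicalSpace Y] {U : Set Y}
    {φ f : Y → ℝ} (hφ : Continuous φ) (hU : IsOpen U) (hφU : tsupport φ ⊆ U)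
    (hf : ContinuousOn f U) : Continuous fun x ↦ φ x * f x :=
  continuous_of_tsupport fun _ hx ↦ hφ.continuousAt.mul
    (hf.continuousAt (hU.mem_nhds (hφU (tsupport_mul_subset_left hx))))

variable [RiemannianBundle (fun x : M ↦ TangentSpace (𝓡 n) x)]

/-- The divergence of a vector field computed in the chart centred at `q`, at any point of the
domain of that chart; `divergence` is the case where `q` is the point itself. -/
def chartDivergence (q : M) (X : ∀ x : M, TangentSpace (𝓡 n) x) (x : M) : ℝ :=
  (volDensity q (chart q x))⁻¹ *
    ∑ j : Fin n, fderiv ℝ (fun y ↦ volDensity q y * vecComponent X q j y)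
      (chart q x) (EuclideanSpace.single j (1 : ℝ))

variable [IsManifold (𝓡 n) ∞ M]
  [IsContMDiffRiemannianBundle (𝓡 n) ∞ (EuclideanSpace ℝ (Fin n))
    (fun x : M ↦ TangentSpace (𝓡 n) x)]
  {X : ∀ x : M, TangentSpace (𝓡 n) x}

theorem contDiffOn_volDensity_mul_vecComponent
    (hX : ContMDiff (𝓡 n) (𝓡 n).tangent 1 fun x ↦ (⟨x, X x⟩ : TangentBundle (𝓡 n) M))
    (q : M) (j : Fin n) :
    ContDiffOn ℝ 1 (fun y ↦ volDensity q y * vecComponent X q j y) (chart q).target :=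
  ((contDiffOn_volDensity q).of_le (by simp)).mul
    ((contMDiff_iff_contDiffOn_vecComponent (by simp)).1 hX q j)

theorem continuousOn_chartDivergence
    (hX : ContMDiff (𝓡 n) (𝓡 n).tangent 1 fun x ↦ (⟨x, X x⟩ : TangentBundle (𝓡 n) M)) (q : M) :
    ContinuousOn (chartDivergence q X) (chart q).source := by
  have hmaps := (chart q).mapsTo
  refine (((contDiffOn_volDensity q).continuousOn.comp (chart q).continuousOn hmaps).inv₀
    fun x hx ↦ (volDensity_pos (hmaps hx)).ne').mul (continuousOn_finsetSum _ fun j _ ↦ ?_)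
  exact (((contDiffOn_volDensity_mul_vecComponent hX q j).continuousOn_fderiv_of_isOpen
    (chart q).open_target le_rfl).clm_apply continuousOn_const).comp (chart q).continuousOn hmaps

theorem chartDivergence_smul {φ : M → ℝ} (hφ : ContMDiff (𝓡 n) 𝓘(ℝ, ℝ) 1 φ)
    (hX : ContMDiff (𝓡 n) (𝓡 n).tangent 1 fun x ↦ (⟨x, X x⟩ : TangentBundle (𝓡 n) M))
    {q x : M} (hx : x ∈ (chart q).source) :
    chartDivergence q (fun x ↦ φ x • X x) x = φ x * chartDivergence q X x + dirDeriv φ X x := by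
  have hy := (chart q).map_source hx
  have hnhds := (chart q).open_target.mem_nhds hy
  have hprod (j : Fin n) : fderiv ℝ
      (fun y ↦ volDensity q y * vecComponent (fun x ↦ φ x • X x) q j y) (chart q x) =
      φ x • fderiv ℝ (fun y ↦ volDensity q y * vecComponent X q j y) (chart q x) +
        (volDensity q (chart q x) * vecComponent X q j (chart q x)) •
          fderiv ℝ (inChart q φ) (chart q x) := by
    simp only [vecComponent_smul, mul_left_comm (volDensity q _)]
    rw [fderiv_fun_mul
      (((contDiffOn_inChart (by simp) q hφ).contDiffAt hnhds).differentiableAt one_ne_zero)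
      (((contDiffOn_volDensity_mul_vecComponent hX q j).contDiffAt hnhds).differentiableAt
        one_ne_zero), inChart, (chart q).left_inv hx]
  have hdir := dirDeriv_eq_sum hy (hφ.mdifferentiable one_ne_zero) X
  rw [(chart q).left_inv hx] at hdir
  simp only [chartDivergence, hprod, hdir, add_apply,
    smul_apply, smul_eq_mul, Finset.sum_add_distrib, mul_assoc,
    ← Finset.mul_sum]
  rw [mul_add, inv_mul_cancel_left₀ (volDensity_pos hy).ne', mul_left_comm]
  simp only [mul_comm]

variable [T2Space M] [CompactSpace M] [MeasurableSpace M] [BorelSpace M]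

theorem setIntegral_chartDivergence_eq_zero
    (hX : ContMDiff (𝓡 n) (𝓡 n).tangent 1 fun x ↦ (⟨x, X x⟩ : TangentBundle (𝓡 n) M))
    {q : M} {K : Set M} (hK : IsCompact K) (hKq : K ⊆ (chart q).source)
    (hXK : ∀ x ∉ K, X x = 0) :
    ∫ x in (chart q).source, chartDivergence q X x ∂(riemannianVolume n M) = 0 := by
  have himage : IsCompact (chart q '' K) :=
    hK.image_of_continuousOn ((chart q).continuousOn.mono hKq)
  have htarget : chart q '' K ⊆ (chart q).target := ((chart q).mapsTo.mono_left hKq).image_subset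
  have hzero (j : Fin n) (y : ℝⁿ) (hy : y ∈ (chart q).target \ chart q '' K) :
      volDensity q y * vecComponent X q j y = 0 := by
    have hX0 := hXK ((chart q).symm y) fun h ↦ hy.2 ⟨_, h, (chart q).right_inv hy.1⟩
    rw [vecComponent_apply, hX0]
    exact mul_eq_zero_of_right _ (congrArg (fun v : ℝⁿ ↦ v j) (map_zero (coframe q _)))
  have hC1 (j : Fin n) := contDiffOn_volDensity_mul_vecComponent hX q j
  calc ∫ x in (chart q).source, chartDivergence q X x ∂(riemannianVolume n M)
      = ∫ y in (chart q).target, ∑ j : Fin n,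
          fderiv ℝ (fun y ↦ volDensity q y * vecComponent X q j y) y
            (EuclideanSpace.single j 1) := by
        rw [setIntegral_chart_source (continuousOn_chartDivergence hX q)]
        refine setIntegral_congr_fun (chart q).open_target.measurableSet fun y hy ↦ ?_
        simp only [chartDivergence, (chart q).right_inv hy]
        exact mul_inv_cancel_left₀ (volDensity_pos hy).ne' _
    _ = ∑ j : Fin n, ∫ y in (chart q).target,
          fderiv ℝ (fun y ↦ volDensity q y * vecComponent X q j y) y
            (EuclideanSpace.single j 1) :=
        integral_finsetSum _ fun j _ ↦ integrableOn_fderiv_apply volume (chart q).open_target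
          himage htarget (hC1 j) (hzero j) _
    _ = 0 := Finset.sum_eq_zero fun j _ ↦ setIntegral_fderiv_apply_eq_zero volume
          (chart q).open_target himage htarget (hC1 j) (hzero j) _

theorem integral_mul_chartDivergence {φ : M → ℝ} (hφ : ContMDiff (𝓡 n) 𝓘(ℝ, ℝ) 1 φ)
    (hX : ContMDiff (𝓡 n) (𝓡 n).tangent 1 fun x ↦ (⟨x, X x⟩ : TangentBundle (𝓡 n) M))
    {q : M} (hφq : tsupport φ ⊆ (chart q).source) :
    ∫ x, φ x * chartDivergence q X x ∂(riemannianVolume n M) =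
      -∫ x, dirDeriv φ X x ∂(riemannianVolume n M) := by
  have hφdiv : Continuous fun x ↦ φ x * chartDivergence q X x :=
    continuous_mul_of_tsupport_subset hφ.continuous (chart q).open_source hφq
      (continuousOn_chartDivergence hX q)
  have hdir := continuous_dirDeriv hφ hX.continuous
  rw [eq_neg_iff_add_eq_zero, ← integral_add (integrable_riemannianVolume_of_continuous hφdiv)
    (integrable_riemannianVolume_of_continuous hdir),
    ← setIntegral_chartDivergence_eq_zero (contMDiff_smul_vectorField (by simp) hφ hX)
      (HasCompactSupport.of_compactSpace φ) hφq fun x hx ↦ by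
        rw [image_eq_zero_of_notMem_tsupport hx, zero_smul],
    ← setIntegral_eq_integral_of_forall_compl_eq_zero (s := (chart q).source) fun x hx ↦ by
      have hxφ : x ∉ tsupport φ := fun h ↦ hx (hφq h)
      rw [image_eq_zero_of_notMem_tsupport hxφ, dirDeriv_eq_zero_of_notMem_tsupport hxφ,
        zero_mul, add_zero]]
  exact setIntegral_congr_fun (chart q).open_source.measurableSet fun x hx ↦
    (chartDivergence_smul hφ hX hx).symm

theorem chartDivergence_eqOn
    (hX : ContMDiff (𝓡 n) (𝓡 n).tangent 1 fun x ↦ (⟨x, X x⟩ : TangentBundle (𝓡 n) M)) (p q : M) :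
    Set.EqOn (chartDivergence p X) (chartDivergence q X)
      ((chart p).source ∩ (chart q).source) := by
  have hU : IsOpen ((chart p).source ∩ (chart q).source) :=
    (chart p).open_source.inter (chart q).open_source
  have hp := (continuousOn_chartDivergence hX p).mono
    (Set.inter_subset_left (t := (chart q).source))
  have hq := (continuousOn_chartDivergence hX q).mono
    (Set.inter_subset_right (s := (chart p).source))
  refine Measure.eqOn_open_of_ae_eq (μ := riemannianVolume n M) ?_ hU hp hq
  rw [EventuallyEq, ae_restrict_iff' hU.measurableSet]
  -- Both functions are the weak divergence of `X` on the intersection of the two domains.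
  have hweak := hU.ae_eq_zero_of_integral_contMDiff_smul_eq_zero (𝓡 n) (μ := riemannianVolume n M)
    (f := fun x ↦ chartDivergence p X x - chartDivergence q X x)
    ((hp.sub hq).locallyIntegrableOn hU.measurableSet) fun φ hφ _ hφU ↦ by
      have hint {f : M → ℝ} (hf : ContinuousOn f ((chart p).source ∩ (chart q).source)) :
          Integrable (fun x ↦ φ x * f x) (riemannianVolume n M) :=
        integrable_riemannianVolume_of_continuous
          (continuous_mul_of_tsupport_subset hφ.continuous hU hφU hf)
      have hφ1 := hφ.of_le (m := 1) (by simp)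
      simp only [smul_eq_mul, mul_sub]
      rw [integral_sub (hint hp) (hint hq),
        integral_mul_chartDivergence hφ1 hX (hφU.trans Set.inter_subset_left),
        integral_mul_chartDivergence hφ1 hX (hφU.trans Set.inter_subset_right), sub_self]
  filter_upwards [hweak] with x hx hxU using sub_eq_zero.1 (hx hxU)

theorem divergence_eq_chartDivergence
    (hX : ContMDiff (𝓡 n) (𝓡 n).tangent 1 fun x ↦ (⟨x, X x⟩ : TangentBundle (𝓡 n) M))
    {q x : M} (hx : x ∈ (chart q).source) : divergence X x = chartDivergence q X x :=
  chartDivergence_eqOn hX x q ⟨mem_chart_source ℝⁿ x, hx⟩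

theorem continuous_divergence
    (hX : ContMDiff (𝓡 n) (𝓡 n).tangent 1 fun x ↦ (⟨x, X x⟩ : TangentBundle (𝓡 n) M)) :
    Continuous (divergence X) :=
  continuous_iff_continuousAt.2 fun q ↦ ((continuousOn_chartDivergence hX q).congr fun _ hx ↦
    divergence_eq_chartDivergence hX hx).continuousAt
    ((chart q).open_source.mem_nhds (mem_chart_source ℝⁿ q))

theorem integral_mul_divergence {φ : M → ℝ} (hφ : ContMDiff (𝓡 n) 𝓘(ℝ, ℝ) 1 φ)
    (hX : ContMDiff (𝓡 n) (𝓡 n).tangent 1 fun x ↦ (⟨x, X x⟩ : TangentBundle (𝓡 n) M)) :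
    ∫ x, φ x * divergence X x ∂(riemannianVolume n M) =
      -∫ x, dirDeriv φ X x ∂(riemannianVolume n M) := by
  let ψ (p x : M) : ℝ := chartPartition n M p x * φ x
  have hψ (p : M) : ContMDiff (𝓡 n) 𝓘(ℝ, ℝ) 1 (ψ p) :=
    ((chartPartition n M p).contMDiff.of_le (by simp)).mul hφ
  have hψp (p : M) : tsupport (ψ p) ⊆ (chart p).source :=
    (tsupport_mul_subset_left (f := chartPartition n M p) (g := φ)).trans
      (tsupport_chartPartition_subset p)
  have hsum : φ = ∑ p ∈ chartPartitionIndices n M, ψ p := by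
    ext x
    rw [Finset.sum_apply, ← Finset.sum_mul, sum_chartPartition, one_mul]
  have hlocal (p : M) : ∫ x, ψ p x * divergence X x ∂(riemannianVolume n M) =
      -∫ x, dirDeriv (ψ p) X x ∂(riemannianVolume n M) := by
    rw [← integral_mul_chartDivergence (hψ p) hX (hψp p)]
    refine integral_congr_ae (ae_of_all _ fun x ↦ ?_)
    by_cases hx : x ∈ (chart p).source
    · exact congrArg (ψ p x * ·) (divergence_eq_chartDivergence hX hx)
    · have hψx : ψ p x = 0 := image_eq_zero_of_notMem_tsupport fun h ↦ hx (hψp p h)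
      simp only [hψx, zero_mul]
  calc ∫ x, φ x * divergence X x ∂(riemannianVolume n M)
      = ∑ p ∈ chartPartitionIndices n M,
          ∫ x, ψ p x * divergence X x ∂(riemannianVolume n M) := by
        rw [← integral_finsetSum _ fun p _ ↦ integrable_riemannianVolume_of_continuous
          ((hψ p).continuous.fun_mul (continuous_divergence hX))]
        simp only [← Finset.sum_mul, ← Finset.sum_apply, ← hsum]
    _ = -∑ p ∈ chartPartitionIndices n M, ∫ x, dirDeriv (ψ p) X x ∂(riemannianVolume n M) := by
        rw [← Finset.sum_neg_distrib]
        exact Finset.sum_congr rfl fun p _ ↦ hlocal p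
    _ = -∫ x, dirDeriv φ X x ∂(riemannianVolume n M) := by
        rw [← integral_finsetSum _ fun p _ ↦ integrable_riemannianVolume_of_continuous
          (continuous_dirDeriv (hψ p) hX.continuous), hsum]
        simp only [dirDeriv_sum fun p _ ↦ (hψ p).mdifferentiable one_ne_zero _]

end Divergence

section GradInner

theorem eq_of_mfderiv_eq_zero [IsManifold (𝓡 n) ∞ M] [PreconnectedSpace M] {f : M → ℝ}
    (hf : ContMDiff (𝓡 n) 𝓘(ℝ, ℝ) 1 f) (h : ∀ x, mfderiv (𝓡 n) 𝓘(ℝ, ℝ) f x = 0) (x y : M) :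
    f x = f y := by
  have hchart (p : M) (t : Set ℝ) : IsOpen ((chart p).target ∩ inChart p f ⁻¹' t) :=
    (chart p).open_target.isOpen_inter_preimage_of_fderiv_eq_zero
      ((contDiffOn_inChart (by simp) p hf).differentiableOn one_ne_zero)
      (fun y hy ↦ ContinuousLinearMap.ext fun v ↦ by
        rw [fderiv_inChart hy (hf.mdifferentiable one_ne_zero), h]
        rfl) t
  have hlocal : IsLocallyConstant f := fun t ↦ isOpen_iff_mem_nhds.2 fun p hp ↦ by
    have hpp := mem_chart_source ℝⁿ p
    filter_upwards [((chart p).isOpen_inter_preimage (hchart p t)).mem_nhds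
      ⟨hpp, (chart p).map_source hpp, by
        rwa [Set.mem_preimage, inChart, (chart p).left_inv hpp]⟩] with z hz
    have hzt := hz.2.2
    rwa [Set.mem_preimage, inChart, (chart p).left_inv hz.1] at hzt
  exact hlocal.apply_eq_of_isPreconnected isPreconnected_univ (Set.mem_univ x) (Set.mem_univ y)

variable [RiemannianBundle (fun x : M ↦ TangentSpace (𝓡 n) x)]

variable (n) in
/-- The function `⟨∇u, ∇v⟩`. -/
def gradInner (u v : M → ℝ) (x : M) : ℝ :=
  inner ℝ (grad (n := n) u x) (grad v x)

theorem gradInner_comm (u v : M → ℝ) (x : M) : gradInner n u v x = gradInner n v u x :=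
  real_inner_comm _ _

theorem gradInner_self (u : M → ℝ) (x : M) :
    gradInner n u u x = ‖(grad u x : TangentSpace (𝓡 n) x)‖ ^ 2 :=
  real_inner_self_eq_norm_sq _

theorem gradInner_self_nonneg (u : M → ℝ) (x : M) : 0 ≤ gradInner n u u x :=
  real_inner_self_nonneg

theorem gradInner_eq_dirDeriv (u v : M → ℝ) (x : M) :
    gradInner n u v x = dirDeriv (n := n) u (grad v) x :=
  inner_grad_left u (grad v) x

theorem dirDeriv_smul_grad (a u v : M → ℝ) (x : M) :
    dirDeriv v (fun x ↦ a x • grad (n := n) u x) x = a x * gradInner n u v x := by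
  rw [dirDeriv_smul, gradInner_comm, gradInner_eq_dirDeriv]

theorem gradInner_mul_left {φ ψ : M → ℝ} {x : M} (hφ : MDifferentiableAt (𝓡 n) 𝓘(ℝ, ℝ) φ x)
    (hψ : MDifferentiableAt (𝓡 n) 𝓘(ℝ, ℝ) ψ x) (v : M → ℝ) :
    gradInner n (fun x ↦ φ x * ψ x) v x =
      φ x * gradInner n ψ v x + ψ x * gradInner n φ v x := by
  simp only [gradInner_eq_dirDeriv]
  exact dirDeriv_mul hφ hψ _

theorem gradInner_comp_right {g : ℝ → ℝ} {g' : ℝ} {φ : M → ℝ} {x : M}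
    (hg : HasDerivAt g g' (φ x)) (hφ : MDifferentiableAt (𝓡 n) 𝓘(ℝ, ℝ) φ x) (v : M → ℝ) :
    gradInner n v (fun x ↦ g (φ x)) x = g' * gradInner n v φ x := by
  simp only [gradInner_comm v, gradInner_eq_dirDeriv]
  exact dirDeriv_comp hg hφ _

theorem sq_mul_gradInner_div_left {u v : M → ℝ} {x : M}
    (hu : MDifferentiableAt (𝓡 n) 𝓘(ℝ, ℝ) u x) (hv : MDifferentiableAt (𝓡 n) 𝓘(ℝ, ℝ) v x)
    (hvx : v x ≠ 0) (w : M → ℝ) :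
    v x ^ 2 * gradInner n (fun x ↦ u x / v x) w x =
      v x * gradInner n u w x - u x * gradInner n v w x := by
  have hinv := hasDerivAt_inv hvx
  have hv' : MDifferentiableAt (𝓡 n) 𝓘(ℝ, ℝ) (fun x ↦ (v x)⁻¹) x :=
    hinv.differentiableAt.mdifferentiableAt.comp x hv
  simp only [div_eq_mul_inv]
  rw [gradInner_mul_left hu hv', gradInner_comm (fun x ↦ (v x)⁻¹), gradInner_comp_right hinv hv,
    gradInner_comm w]
  field

theorem mfderiv_eq_zero_of_gradInner_self_eq_zero {u : M → ℝ} {x : M}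
    (h : gradInner n u u x = 0) : mfderiv (𝓡 n) 𝓘(ℝ, ℝ) u x = 0 := by
  have hgrad : (grad u x : TangentSpace (𝓡 n) x) = 0 := inner_self_eq_zero.1 h
  exact (LinearIsometryEquiv.map_eq_zero_iff _).1 hgrad

variable [IsManifold (𝓡 n) ∞ M]
  [IsContMDiffRiemannianBundle (𝓡 n) ∞ (EuclideanSpace ℝ (Fin n))
    (fun x : M ↦ TangentSpace (𝓡 n) x)]

theorem continuous_gradInner {u v : M → ℝ} (hu : ContMDiff (𝓡 n) 𝓘(ℝ, ℝ) 1 u)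
    (hv : ContMDiff (𝓡 n) 𝓘(ℝ, ℝ) 1 v) : Continuous (gradInner n u v) :=
  (continuous_dirDeriv hu (contMDiff_grad (m := 0) (by simp) (by simpa using hv)).continuous).congr
    fun x ↦ (gradInner_eq_dirDeriv u v x).symm

end GradInner

section Green

variable [RiemannianBundle (fun x : M ↦ TangentSpace (𝓡 n) x)] [IsManifold (𝓡 n) ∞ M]
  [IsContMDiffRiemannianBundle (𝓡 n) ∞ (EuclideanSpace ℝ (Fin n))
    (fun x : M ↦ TangentSpace (𝓡 n) x)]
  {a c u v : M → ℝ}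

theorem contMDiff_smul_grad (ha : ContMDiff (𝓡 n) 𝓘(ℝ, ℝ) 1 a)
    (hu : ContMDiff (𝓡 n) 𝓘(ℝ, ℝ) 2 u) :
    ContMDiff (𝓡 n) (𝓡 n).tangent 1
      fun x ↦ (⟨x, a x • grad u x⟩ : TangentBundle (𝓡 n) M) := by
  have h2 : (1 + 1 : WithTop ℕ∞) ≤ (∞ : WithTop ℕ∞) :=
    one_add_one_eq_two.le.trans (WithTop.coe_le_coe.2 (le_top : (2 : ℕ∞) ≤ ⊤))
  exact contMDiff_smul_vectorField (by simp) ha (contMDiff_grad h2 (hu.of_le one_add_one_eq_two.le))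

variable [T2Space M] [CompactSpace M] [MeasurableSpace M] [BorelSpace M]

theorem continuous_opL (ha : ContMDiff (𝓡 n) 𝓘(ℝ, ℝ) 1 a) (hc : Continuous c)
    (hu : ContMDiff (𝓡 n) 𝓘(ℝ, ℝ) 2 u) : Continuous (opL n a c u) :=
  (continuous_divergence (contMDiff_smul_grad ha hu)).neg.add (hc.mul hu.continuous)

theorem integral_mul_opL (ha : ContMDiff (𝓡 n) 𝓘(ℝ, ℝ) 1 a) (hc : Continuous c)
    (hu : ContMDiff (𝓡 n) 𝓘(ℝ, ℝ) 2 u) (hv : ContMDiff (𝓡 n) 𝓘(ℝ, ℝ) 1 v) :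
    ∫ x, v x * opL n a c u x ∂(riemannianVolume n M) =
      ∫ x, (a x * gradInner n u v x + c x * (u x * v x)) ∂(riemannianVolume n M) := by
  have hX := contMDiff_smul_grad ha hu
  have hdiv : Integrable (fun x ↦ v x * divergence (n := n) (fun z ↦ a z • grad u z) x)
      (riemannianVolume n M) :=
    integrable_riemannianVolume_of_continuous (hv.continuous.mul (continuous_divergence hX))
  have hcuv : Integrable (fun x ↦ c x * (u x * v x)) (riemannianVolume n M) :=
    integrable_riemannianVolume_of_continuous (hc.mul (hu.continuous.mul hv.continuous))
  have hagrad : Integrable (fun x ↦ a x * gradInner n u v x) (riemannianVolume n M) :=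
    integrable_riemannianVolume_of_continuous
      (ha.continuous.mul (continuous_gradInner (hu.of_le one_le_two) hv))
  have hparts := integral_mul_divergence hv hX
  simp only [dirDeriv_smul_grad] at hparts
  rw [integral_add hagrad hcuv, ← neg_eq_iff_eq_neg.2 hparts, ← integral_neg,
    ← integral_add hdiv.fun_neg hcuv]
  refine integral_congr_ae (ae_of_all _ fun x ↦ ?_)
  simp only [opL]
  ring

theorem integral_mul_lagrange_opL (ha : ContMDiff (𝓡 n) 𝓘(ℝ, ℝ) 1 a) (hc : Continuous c)
    (hu : ContMDiff (𝓡 n) 𝓘(ℝ, ℝ) 2 u) (hv : ContMDiff (𝓡 n) 𝓘(ℝ, ℝ) 2 v)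
    (hv0 : ∀ x, v x ≠ 0) {φ : M → ℝ} (hφ : ContMDiff (𝓡 n) 𝓘(ℝ, ℝ) 1 φ) :
    ∫ x, φ x * (v x * opL n a c u x - u x * opL n a c v x) ∂(riemannianVolume n M) =
      ∫ x, a x * (v x ^ 2 * gradInner n (fun x ↦ u x / v x) φ x) ∂(riemannianVolume n M) := by
  have hint {w z : M → ℝ} (hw : ContMDiff (𝓡 n) 𝓘(ℝ, ℝ) 2 w)
      (hz : ContMDiff (𝓡 n) 𝓘(ℝ, ℝ) 1 z) :
      Integrable (fun x ↦ z x * opL n a c w x) (riemannianVolume n M) ∧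
        Integrable (fun x ↦ a x * gradInner n w z x + c x * (w x * z x))
          (riemannianVolume n M) :=
    ⟨integrable_riemannianVolume_of_continuous (hz.continuous.mul (continuous_opL ha hc hw)),
      integrable_riemannianVolume_of_continuous
        ((ha.continuous.mul (continuous_gradInner (hw.of_le one_le_two) hz)).add
          (hc.mul (hw.continuous.mul hz.continuous)))⟩
  have hφu : ContMDiff (𝓡 n) 𝓘(ℝ, ℝ) 1 fun x ↦ φ x * u x := hφ.mul (hu.of_le one_le_two)
  have hφv : ContMDiff (𝓡 n) 𝓘(ℝ, ℝ) 1 fun x ↦ φ x * v x := hφ.mul (hv.of_le one_le_two)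
  have hgrad {w z : M → ℝ} (hz : ContMDiff (𝓡 n) 𝓘(ℝ, ℝ) 2 z) (x : M) :
      gradInner n w (fun x ↦ φ x * z x) x = φ x * gradInner n w z x + z x * gradInner n w φ x := by
    simp only [gradInner_comm w]
    exact gradInner_mul_left (hφ.mdifferentiable one_ne_zero x)
      (hz.mdifferentiable two_ne_zero x) w
  calc ∫ x, φ x * (v x * opL n a c u x - u x * opL n a c v x) ∂(riemannianVolume n M)
      = (∫ x, φ x * v x * opL n a c u x ∂(riemannianVolume n M)) -
          ∫ x, φ x * u x * opL n a c v x ∂(riemannianVolume n M) := by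
        rw [← integral_sub (hint hu hφv).1 (hint hv hφu).1]
        simp only [mul_sub, mul_assoc]
    _ = _ := by
        rw [integral_mul_opL ha hc hu hφv, integral_mul_opL ha hc hv hφu,
          ← integral_sub (hint hu hφv).2 (hint hv hφu).2]
        refine integral_congr_ae (ae_of_all _ fun x ↦ ?_)
        simp only [hgrad hv, hgrad hu, gradInner_comm v u,
          sq_mul_gradInner_div_left (hu.mdifferentiable two_ne_zero x)
            (hv.mdifferentiable two_ne_zero x) (hv0 x)]
        ring

end Green

section Energy

theorem integral_sq_pos {α : Type*} [MeasurableSpace α] {μ : Measure α} {u : α → ℝ}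
    (hu : MemLp u 2 μ) (hne : ¬ u =ᵐ[μ] 0) : 0 < ∫ x, u x ^ 2 ∂μ := by
  refine (integral_nonneg fun x ↦ sq_nonneg (u x)).lt_of_ne' fun h0 ↦ hne ?_
  filter_upwards [(integral_eq_zero_iff_of_nonneg (fun x ↦ sq_nonneg (u x))
    hu.integrable_sq).1 h0] with x hx using (pow_eq_zero_iff two_ne_zero).1 hx

variable [RiemannianBundle (fun x : M ↦ TangentSpace (𝓡 n) x)] [IsManifold (𝓡 n) ∞ M]
  [T2Space M] [CompactSpace M] [MeasurableSpace M] {a c u : M → ℝ}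
  {X : ∀ x : M, TangentSpace (𝓡 n) x}

theorem intInvFour_nonneg (u : M → ℝ) : 0 ≤ intInvFour n u :=
  integral_nonneg fun x ↦ inv_nonneg.2 (Even.pow_nonneg (by decide) (u x))

variable [BorelSpace M]

theorem HasSobolevGradient.const_mul_integral_sq_le (h : HasSobolevGradient u X)
    (ha : Continuous a) (ha0 : ∀ x, 0 ≤ a x) (hc : Continuous c) {C : ℝ} (hC : ∀ x, C ≤ c x) :
    C * ∫ x, u x ^ 2 ∂(riemannianVolume n M) ≤
      ∫ x, (a x * ‖X x‖ ^ 2 + c x * u x ^ 2) ∂(riemannianVolume n M) := by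
  have hbdd {b f : M → ℝ} (hb : Continuous b) (hf : Integrable f (riemannianVolume n M)) :
      Integrable (fun x ↦ b x * f x) (riemannianVolume n M) := by
    obtain ⟨B, hB⟩ := (isCompact_range hb.norm).bddAbove
    exact hf.bdd_mul hb.aestronglyMeasurable (ae_of_all _ fun x ↦ hB (Set.mem_range_self x))
  have hu2 := h.memLp.integrable_sq
  rw [← integral_const_mul]
  refine integral_mono (hu2.const_mul C)
    ((hbdd ha h.integrable_norm_sq).add (hbdd hc hu2)) fun x ↦ ?_
  exact (mul_le_mul_of_nonneg_right (hC x) (sq_nonneg (u x))).trans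
    (le_add_of_nonneg_left (mul_nonneg (ha0 x) (sq_nonneg ‖X x‖)))

theorem HasSobolevGradient.firstEigenvalue_mul_integral_sq_le (h : HasSobolevGradient u X)
    (ha : Continuous a) (ha0 : ∀ x, 0 ≤ a x) (hc : Continuous c) :
    firstEigenvalue n a c * ∫ x, u x ^ 2 ∂(riemannianVolume n M) ≤
      ∫ x, (a x * ‖X x‖ ^ 2 + c x * u x ^ 2) ∂(riemannianVolume n M) := by
  obtain ⟨C, hC⟩ := (isCompact_range hc).bddBelow
  have hCc (x : M) : C ≤ c x := hC (Set.mem_range_self x)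
  by_cases hu : u =ᵐ[riemannianVolume n M] 0
  · have hu2 : ∫ x, u x ^ 2 ∂(riemannianVolume n M) = 0 :=
      integral_eq_zero_of_ae (hu.mono fun _ hx ↦ (pow_eq_zero_iff two_ne_zero).2 hx)
    have hE := h.const_mul_integral_sq_le ha ha0 hc hCc
    rwa [hu2, mul_zero] at hE ⊢
  · rw [← le_div_iff₀ (integral_sq_pos h.memLp hu)]
    refine csInf_le ⟨C, ?_⟩ ⟨u, X, h, hu, rfl⟩
    rintro _ ⟨v, Y, hv, hv0, rfl⟩
    rw [le_div_iff₀ (integral_sq_pos hv.memLp hv0)]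
    exact hv.const_mul_integral_sq_le ha ha0 hc hCc

variable [IsContMDiffRiemannianBundle (𝓡 n) ∞ (EuclideanSpace ℝ (Fin n))
    (fun x : M ↦ TangentSpace (𝓡 n) x)]

theorem hasSobolevGradient_grad (hu : ContMDiff (𝓡 n) 𝓘(ℝ, ℝ) 1 u) :
    HasSobolevGradient (n := n) u (grad u) where
  memLp := (memLp_two_iff_integrable_sq hu.continuous.aestronglyMeasurable).2
    (integrable_riemannianVolume_of_continuous (hu.continuous.pow 2))
  aestronglyMeasurable_inner Y hY :=
    ((continuous_dirDeriv hu hY.continuous).congr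
      fun x ↦ (inner_grad_left u Y x).symm).aestronglyMeasurable
  integrable_norm_sq := by
    simp only [← gradInner_self]
    exact integrable_riemannianVolume_of_continuous (continuous_gradInner hu hu)
  approx := ⟨fun _ ↦ u, fun _ ↦ hu, by simp, by simp⟩

theorem functionalD_nonneg (ha : Continuous a) (ha0 : ∀ x, 0 ≤ a x) (hc : Continuous c)
    (hlambda : 0 ≤ firstEigenvalue n a c) (hu : ContMDiff (𝓡 n) 𝓘(ℝ, ℝ) 1 u) :
    0 ≤ functionalD n a c u :=
  mul_nonneg (Real.rpow_nonneg (intInvFour_nonneg u) _)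
    ((mul_nonneg hlambda (integral_nonneg fun x ↦ sq_nonneg (u x))).trans
      ((hasSobolevGradient_grad hu).firstEigenvalue_mul_integral_sq_le ha ha0 hc))

theorem infD_nonneg (ha : Continuous a) (ha0 : ∀ x, 0 ≤ a x) (hc : Continuous c)
    (hlambda : 0 ≤ firstEigenvalue n a c) : 0 ≤ infD n a c := by
  refine Real.sInf_nonneg ?_
  rintro _ ⟨u, hu, -, rfl⟩
  exact functionalD_nonneg ha ha0 hc hlambda (hu.of_le (by simp))

end Energy

section Uniqueness

theorem eq_zero_of_integral_nonpos {Y : Type*} [TopologicalSpace Y] [CompactSpace Y]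
    [MeasurableSpace Y] [OpensMeasurableSpace Y] {μ : Measure Y} [IsFiniteMeasureOnCompacts μ]
    [μ.IsOpenPosMeasure] {f : Y → ℝ} (hf : Continuous f) (h0 : ∀ y, 0 ≤ f y)
    (hint : ∫ y, f y ∂μ ≤ 0) (y : Y) : f y = 0 := by
  by_contra hy
  exact hint.not_gt (hf.integral_pos_of_hasCompactSupport_nonneg_nonzero
    (HasCompactSupport.of_compactSpace f) h0 hy)

variable [RiemannianBundle (fun x : M ↦ TangentSpace (𝓡 n) x)] [IsManifold (𝓡 n) ∞ M]
  [IsContMDiffRiemannianBundle (𝓡 n) ∞ (EuclideanSpace ℝ (Fin n))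
    (fun x : M ↦ TangentSpace (𝓡 n) x)]
  [T2Space M] [CompactSpace M] [MeasurableSpace M] [BorelSpace M] {a c u v : M → ℝ}

theorem exists_eq_mul_of_mul_opL_eq [ConnectedSpace M] (ha : ContMDiff (𝓡 n) 𝓘(ℝ, ℝ) 1 a)
    (ha_pos : ∀ x, 0 < a x) (hc : Continuous c) (hu : ContMDiff (𝓡 n) 𝓘(ℝ, ℝ) 2 u)
    (hv : ContMDiff (𝓡 n) 𝓘(ℝ, ℝ) 2 v) (hu_pos : ∀ x, 0 < u x) (hv_pos : ∀ x, 0 < v x)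
    (h : ∀ x, v x * opL n a c u x = u x * opL n a c v x) :
    ∃ β : ℝ, 0 < β ∧ ∀ x, u x = β * v x := by
  have hv0 (x : M) : v x ≠ 0 := (hv_pos x).ne'
  have hf : ContMDiff (𝓡 n) 𝓘(ℝ, ℝ) 1 fun x ↦ u x / v x := (hu.div₀ hv hv0).of_le one_le_two
  have hlagrange := integral_mul_lagrange_opL ha hc hu hv hv0 hf
  simp only [h, sub_self, mul_zero, integral_zero] at hlagrange
  have hgrad (x : M) : gradInner n (fun x ↦ u x / v x) (fun x ↦ u x / v x) x = 0 := by
    have hzero := eq_zero_of_integral_nonpos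
      (ha.continuous.mul ((hv.continuous.pow 2).mul (continuous_gradInner hf hf)))
      (fun x ↦ mul_nonneg (ha_pos x).le (mul_nonneg (sq_nonneg _) (gradInner_self_nonneg _ x)))
      hlagrange.ge x
    exact (mul_eq_zero.1 ((mul_eq_zero.1 hzero).resolve_left (ha_pos x).ne')).resolve_left
      (pow_ne_zero 2 (hv0 x))
  obtain ⟨x₀⟩ : Nonempty M := inferInstance
  refine ⟨u x₀ / v x₀, div_pos (hu_pos x₀) (hv_pos x₀), fun x ↦ ?_⟩
  rw [← eq_of_mfderiv_eq_zero hf (fun y ↦ mfderiv_eq_zero_of_gradInner_self_eq_zero (hgrad y)) x x₀,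
    div_mul_cancel₀ _ (hv0 x)]

theorem integral_comp_div_mul_lagrange_opL_nonneg (ha : ContMDiff (𝓡 n) 𝓘(ℝ, ℝ) 1 a)
    (ha0 : ∀ x, 0 ≤ a x) (hc : Continuous c) (hu : ContMDiff (𝓡 n) 𝓘(ℝ, ℝ) 2 u)
    (hv : ContMDiff (𝓡 n) 𝓘(ℝ, ℝ) 2 v) (hu_pos : ∀ x, 0 < u x) (hv_pos : ∀ x, 0 < v x)
    {g : ℝ → ℝ} (hg : ContDiffOn ℝ 1 g (Set.Ioi 0)) (hmono : MonotoneOn g (Set.Ioi 0)) :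
    0 ≤ ∫ x, g (u x / v x) * (v x * opL n a c u x - u x * opL n a c v x)
      ∂(riemannianVolume n M) := by
  have hv0 (x : M) : v x ≠ 0 := (hv_pos x).ne'
  have hf_pos (x : M) : u x / v x ∈ Set.Ioi 0 := div_pos (hu_pos x) (hv_pos x)
  have hf : ContMDiff (𝓡 n) 𝓘(ℝ, ℝ) 1 fun x ↦ u x / v x := (hu.div₀ hv hv0).of_le one_le_two
  have hφ : ContMDiff (𝓡 n) 𝓘(ℝ, ℝ) 1 fun x ↦ g (u x / v x) :=
    hg.contMDiffOn.comp_contMDiff hf hf_pos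
  rw [integral_mul_lagrange_opL ha hc hu hv hv0 hφ]
  refine integral_nonneg fun x ↦ ?_
  have hderiv : HasDerivAt g (derivWithin g (Set.Ioi 0) (u x / v x)) (u x / v x) :=
    (hg.differentiableOn one_ne_zero _ (hf_pos x)).hasDerivWithinAt.hasDerivAt
      (Ioi_mem_nhds (hf_pos x))
  rw [gradInner_comp_right (φ := fun x ↦ u x / v x) hderiv (hf.mdifferentiable one_ne_zero x)]
  exact mul_nonneg (ha0 x) (mul_nonneg (sq_nonneg _)
    (mul_nonneg hmono.derivWithin_nonneg (gradInner_self_nonneg _ x)))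

theorem mul_opL_eq_of_opL_eq_inv_pow (ha : ContMDiff (𝓡 n) 𝓘(ℝ, ℝ) 1 a) (ha0 : ∀ x, 0 ≤ a x)
    (hc : Continuous c) (hu : ContMDiff (𝓡 n) 𝓘(ℝ, ℝ) 2 u)
    (hv : ContMDiff (𝓡 n) 𝓘(ℝ, ℝ) 2 v) (hu_pos : ∀ x, 0 < u x) (hv_pos : ∀ x, 0 < v x)
    {k : ℕ} {K₁ K₂ : ℝ} (hK₁ : 0 ≤ K₁) (hLu : ∀ x, opL n a c u x = K₁ * (u x ^ k)⁻¹)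
    (hLv : ∀ x, opL n a c v x = K₂ * (v x ^ k)⁻¹) (x : M) :
    v x * opL n a c u x = u x * opL n a c v x := by
  let g (t : ℝ) : ℝ := K₂ - K₁ * (t ^ (k + 1))⁻¹
  have hg : ContDiffOn ℝ 1 g (Set.Ioi 0) := contDiffOn_const.sub (contDiffOn_const.mul
    ((contDiffOn_id.pow (k + 1)).inv fun t ht ↦ (pow_pos ht _).ne'))
  have hmono : MonotoneOn g (Set.Ioi 0) := fun s (hs : 0 < s) t _ hst ↦
    sub_le_sub_left (mul_le_mul_of_nonneg_left
      (inv_anti₀ (pow_pos hs _) (pow_le_pow_left₀ hs.le hst _)) hK₁) K₂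
  have hweight (x : M) : 0 < u x * (v x ^ k)⁻¹ :=
    mul_pos (hu_pos x) (inv_pos.2 (pow_pos (hv_pos x) k))
  have hdefect (x : M) : v x * opL n a c u x - u x * opL n a c v x =
      -(u x * (v x ^ k)⁻¹ * g (u x / v x)) := by
    have := (hu_pos x).ne'
    have := (hv_pos x).ne'
    simp only [hLu, hLv, g, div_pow]
    field
  have hcont : Continuous fun x ↦ u x * (v x ^ k)⁻¹ * g (u x / v x) ^ 2 :=
    (hu.continuous.mul ((hv.continuous.pow k).inv₀ fun x ↦ (pow_pos (hv_pos x) k).ne')).mul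
      ((hg.continuousOn.comp_continuous (hu.continuous.div₀ hv.continuous fun x ↦ (hv_pos x).ne')
        fun x ↦ div_pos (hu_pos x) (hv_pos x)).pow 2)
  have hint : ∫ x, u x * (v x ^ k)⁻¹ * g (u x / v x) ^ 2 ∂(riemannianVolume n M) ≤ 0 := by
    rw [← neg_nonneg, ← integral_neg]
    convert integral_comp_div_mul_lagrange_opL_nonneg ha ha0 hc hu hv hu_pos hv_pos hg hmono
      using 3 with x
    rw [hdefect]
    ring
  have hzero := eq_zero_of_integral_nonpos hcont
    (fun x ↦ mul_nonneg (hweight x).le (sq_nonneg _)) hint x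
  have hgx : g (u x / v x) = 0 :=
    (pow_eq_zero_iff two_ne_zero).1 ((mul_eq_zero.1 hzero).resolve_left (hweight x).ne')
  rw [← sub_eq_zero, hdefect, hgx, mul_zero, neg_zero]

theorem IsPositiveSolution.exists_eq_mul [ConnectedSpace M]
    (ha : ContMDiff (𝓡 n) 𝓘(ℝ, ℝ) 1 a) (ha_pos : ∀ x, 0 < a x) (hc : Continuous c) {d₁ d₂ : ℝ}
    (hd₁ : 0 ≤ d₁) (hu : IsPositiveSolution n a c d₁ u) (hv : IsPositiveSolution n a c d₂ v) :
    ∃ β : ℝ, 0 < β ∧ ∀ x, u x = β * v x :=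
  exists_eq_mul_of_mul_opL_eq ha ha_pos hc hu.contMDiff hv.contMDiff hu.pos hv.pos
    (mul_opL_eq_of_opL_eq_inv_pow ha (fun x ↦ (ha_pos x).le) hc hu.contMDiff hv.contMDiff hu.pos
      hv.pos (mul_nonneg hd₁ (Real.rpow_nonneg (intInvFour_nonneg u) _)) hu.eqn hv.eqn)

end Uniqueness

end ConformalPDE

end

theorem theorem4p7_general {n : ℕ} {M : Type*} [TopologicalSpace M] [T2Space M] [CompactSpace M]
    [ConnectedSpace M] [ChartedSpace (EuclideanSpace ℝ (Fin n)) M] [IsManifold (𝓡 n) ∞ M]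
    [RiemannianBundle (fun x : M ↦ TangentSpace (𝓡 n) x)]
    [IsContMDiffRiemannianBundle (𝓡 n) ∞ (EuclideanSpace ℝ (Fin n))
      (fun x : M ↦ TangentSpace (𝓡 n) x)]
    [MeasurableSpace M] [BorelSpace M]
    (a c : M → ℝ) (ha : ContMDiff (𝓡 n) 𝓘(ℝ, ℝ) 1 a) (ha_pos : ∀ x, 0 < a x)
    (hc : Continuous c) (hlambda : 0 ≤ ConformalPDE.firstEigenvalue n a c) :
    (∀ u₁ u₂ : M → ℝ,
      ConformalPDE.IsPositiveSolution n a c (ConformalPDE.functionalD n a c u₁) u₁ →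
      ConformalPDE.IsPositiveSolution n a c (ConformalPDE.functionalD n a c u₂) u₂ →
      ∃ β : ℝ, 0 < β ∧ ∀ x, u₁ x = β * u₂ x) ∧
    (∀ u₁ u₂ : M → ℝ,
      ConformalPDE.IsPositiveSolution n a c (ConformalPDE.infD n a c) u₁ →
      ConformalPDE.IsPositiveSolution n a c (ConformalPDE.infD n a c) u₂ →
      ∃ β : ℝ, 0 < β ∧ ∀ x, u₁ x = β * u₂ x) := by
  have ha0 (x : M) : 0 ≤ a x := (ha_pos x).le
  refine ⟨fun _ _ h₁ h₂ ↦ ?_, fun _ _ h₁ h₂ ↦ ?_⟩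
  · have hd₁ := ConformalPDE.functionalD_nonneg ha.continuous ha0 hc hlambda
      (h₁.contMDiff.of_le one_le_two)
    exact h₁.exists_eq_mul ha ha_pos hc hd₁ h₂
  · have hd := ConformalPDE.infD_nonneg ha.continuous ha0 hc hlambda
    exact h₁.exists_eq_mul ha ha_pos hc hd h₂

theorem theorem4p7 {M : Type*} [TopologicalSpace M] [T2Space M] [CompactSpace M]
    [ConnectedSpace M] [ChartedSpace (EuclideanSpace ℝ (Fin 4)) M] [IsManifold (𝓡 4) ∞ M]
    [RiemannianBundle (fun x : M ↦ TangentSpace (𝓡 4) x)]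
    [IsContMDiffRiemannianBundle (𝓡 4) ∞ (EuclideanSpace ℝ (Fin 4))
      (fun x : M ↦ TangentSpace (𝓡 4) x)]
    [MeasurableSpace M] [BorelSpace M]
    (a c : M → ℝ) (ha : ContMDiff (𝓡 4) 𝓘(ℝ, ℝ) ∞ a) (ha_pos : ∀ x, 0 < a x)
    (hc : ContMDiff (𝓡 4) 𝓘(ℝ, ℝ) ∞ c) (hlambda : 0 ≤ ConformalPDE.firstEigenvalue 4 a c) :
    (∀ u₁ u₂ : M → ℝ,
      ConformalPDE.IsPositiveSolution 4 a c (ConformalPDE.functionalD 4 a c u₁) u₁ →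
      ConformalPDE.IsPositiveSolution 4 a c (ConformalPDE.functionalD 4 a c u₂) u₂ →
      ∃ β : ℝ, 0 < β ∧ ∀ x, u₁ x = β * u₂ x) ∧
    (∀ u₁ u₂ : M → ℝ,
      ConformalPDE.IsPositiveSolution 4 a c (ConformalPDE.infD 4 a c) u₁ →
      ConformalPDE.IsPositiveSolution 4 a c (ConformalPDE.infD 4 a c) u₂ →
      ∃ β : ℝ, 0 < β ∧ ∀ x, u₁ x = β * u₂ x) := by
  exact theorem4p7_general a c (ha.of_le (by simp)) ha_pos hc.continuous hlambda
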